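/- Let $\lambda$ be the Lebesgue measure on $[0,1]$, let $\mathcal M$ be the set of finite positive measures on $\mathbb R$ with finite first moment, and let $\mathcal P\subset\mathcal M$ be the subset of probability measures. For $\alpha,\beta\in\mathcal M$ write $\alpha\le_c\beta$ (convex order) if $\int\varphi\,d\alpha\le\int\varphi\,d\beta$ for every convex $\varphi:\mathbb R\to\mathbb R$ (the integrals taking values in $(-\infty,+\infty]$), and $\alpha\le\beta$ if $\alpha(A)\le\beta(A)$ for every Borel set $A$. If the set $\{\eta:\alpha\le_c\eta\text{ and }\eta\le\beta\}$ is non-empty, its least element with respect to $\le_c$ is called the shadow of $\alpha$ in $\beta$ and is denoted by $S^\beta(\alpha)$. For a measure $\hat\theta$ on $[0,1]\times E$ (with $E=\mathbb R$ or $\mathbb R^2$) with first marginal $\lambda$, put $\theta_{[0,u]}(A)=\hat\theta([0,u]\times A)$ for $u\in[0,1]$. A measure $\theta_u\in\mathcal M$ is the derivative at $u$ of a curve $(\theta_{[0,t]})_{t\in[0,1]}$ of measures on $\mathbb R$ if, for every continuous $f:\mathbb R\to\mathbb R$ of at most linear growth, $t\mapsto\int f\,d\theta_{[0,t]}$ is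 differentiable at $u$ (as a function on $[0,1]$) with derivative $\int f\,d\theta_u$. For a closed set $T\subset\mathbb R$ and $x\in[\inf T,\sup T]$ let $x_T^-=\sup(T\cap(-\infty,x])$ and $x_T^+=\inf(T\cap[x,\infty))$, and let $P_T(x,\cdot)=\delta_x$ if $x\in T$ and $$P_T(x,\cdot)=\frac{(x_T^+-x)\,\delta_{x_T^-}+(x-x_T^-)\,\delta_{x_T^+}}{x_T^+-x_T^-}$$ if $x\notin T$. If $m$ is a finite measure with $\operatorname{spt} m\subset[\inf T,\sup T]$, its hitting projection $mP_T$ is given by $mP_T(B)=\int P_T(x,B)\,dm(x)$. **Theorem (existence, construction, and uniqueness of the lifted shadow coupling).** Let $\mu,\nu\in\mathcal P$ with $\mu\le_c\nu$, and let $\hat\mu$ be a coupling of $\lambda$ and $\mu$. Let $\hat\Pi_M(\hat\mu,\nu)$ be the set of couplings $\hat\pi$ of $\hat\mu$ and $\nu$, seen as probability measures on $[0,1]\times\mathbb R\times\mathbb R$, whose disintegration $(\hat\pi_{u,x})$ with respect to $\hat\mu$ satisfies $\int y\,d\hat\pi_{u,x}(y)=x$ for $\hat\mu$-a.e. $(u,x)$.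 Then there exists a unique $\hat\pi\in\hat\Pi_M(\hat\mu,\nu)$ such that, for every $u\in[0,1]$, the first marginal of $\pi_{[0,u]}$ is $\mu_{[0,u]}$ and its second marginal is the shadow $\nu_{[0,u]}:=S^\nu(\mu_{[0,u]})$ (in particular this shadow exists). Moreover, let $T(u)$ be the support of $\nu-\nu_{[0,u]}$. For $\lambda$-a.e. $u$ the curves $(\mu_{[0,t]})_{t}$ and $(\nu_{[0,t]})_{t}$ have derivatives $\mu_u$ and $\nu_u$ at $u$, and these are given $\lambda$-a.e. by the disintegrations with respect to $\lambda$ of $\hat\mu$ and of the projection of $\hat\pi$ to the coordinates $(u,y)$. At every $u\in[0,1)$ at which both derivatives exist (hence for $\lambda$-a.e. $u$) one has $\operatorname{spt}\mu_u\subset[\inf T(u),\sup T(u)]$ and $$\nu_u=\mu_u P_{T(u)}.$$ -/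

import Mathlib

open MeasureTheory ProbabilityTheory Set

namespace ShadowCoupling

noncomputable section

/-- The Lebesgue measure `λ` on the unit interval, as a measure on `ℝ` concentrated on `[0,1]`.
Measures on `[0,1] × E` whose first marginal is `λ` are represented by measures on `ℝ × E`. -/
def unitLebesgue : Measure ℝ := volume.restrict (Icc (0 : ℝ) 1)

/-- The positive finite measures on `ℝ` with finite first moment. -/
def FiniteFirstMoment (μ : Measure ℝ) : Prop :=
  IsFiniteMeasure μ ∧ Integrable (fun x : ℝ => x) μ

/-- The convex order. For a measure with finite first moment the integral of a convex function is
always defined in `(-∞, +∞]`; the inequality is void if the right hand side is `+∞`, that is, if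
`φ` is not `ν`-integrable, and otherwise it forces the left hand side to be finite. -/
def ConvexOrder (μ ν : Measure ℝ) : Prop :=
  FiniteFirstMoment μ ∧ FiniteFirstMoment ν ∧
    ∀ φ : ℝ → ℝ, ConvexOn ℝ univ φ → Integrable φ ν →
      Integrable φ μ ∧ ∫ x, φ x ∂μ ≤ ∫ x, φ x ∂ν

/-- `η` is the shadow of `μ` in `ν`: the least element, for the convex order, of the set of
measures `η'` with `μ ≤_c η'` and `η' ≤ ν`. -/
def IsShadow (ν μ η : Measure ℝ) : Prop :=
  ConvexOrder μ η ∧ η ≤ ν ∧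
    ∀ η' : Measure ℝ, ConvexOrder μ η' → η' ≤ ν → ConvexOrder η η'

/-- `μhat` is a lift of `μ`, i.e. a coupling of `λ` and `μ`. -/
def IsLift (μhat : Measure (ℝ × ℝ)) (μ : Measure ℝ) : Prop :=
  μhat.fst = unitLebesgue ∧ μhat.snd = μ

/-- The projection of a measure on `[0,1] × ℝ × ℝ` to the coordinates `(u, x)`. -/
def projUX (πhat : Measure (ℝ × ℝ × ℝ)) : Measure (ℝ × ℝ) :=
  πhat.map (fun p => (p.1, p.2.1))

/-- The projection of a measure on `[0,1] × ℝ × ℝ` to the coordinates `(u, y)`. -/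
def projUY (πhat : Measure (ℝ × ℝ × ℝ)) : Measure (ℝ × ℝ) :=
  πhat.map (fun p => (p.1, p.2.2))

/-- The projection of a measure on `[0,1] × ℝ × ℝ` to the coordinate `y`. -/
def projY (πhat : Measure (ℝ × ℝ × ℝ)) : Measure ℝ :=
  πhat.map (fun p => p.2.2)

/-- The lifted martingale transport plans from `μhat` to `ν`: couplings of `μhat` and `ν` whose
disintegration with respect to `μhat` has barycenter `x` at almost every `(u, x)`. -/
def IsLiftedMartingalePlan (μhat : Measure (ℝ × ℝ)) (ν : Measure ℝ)
    (πhat : Measure (ℝ × ℝ × ℝ)) : Prop :=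
  projUX πhat = μhat ∧ projY πhat = ν ∧
    ∃ κ : Kernel (ℝ × ℝ) ℝ, IsMarkovKernel κ ∧
      (μhat ⊗ₘ κ).map MeasurableEquiv.prodAssoc = πhat ∧
      ∀ᵐ p ∂μhat, ∫ y, y ∂(κ p) = p.2

/-- The primitive curve `θ_{[0,u]}(A) = θhat([0,u] × A)` of a lifted measure. -/
def primitive {E : Type*} [MeasurableSpace E] (θhat : Measure (ℝ × E)) (u : ℝ) : Measure E :=
  (θhat.restrict (Icc 0 u ×ˢ univ)).snd

/-- `κ` is a disintegration `(θ_u)` of the lifted measure `θhat` with respect to `λ`. -/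
def IsDisintegration (θhat : Measure (ℝ × ℝ)) (κ : Kernel ℝ ℝ) : Prop :=
  IsMarkovKernel κ ∧ unitLebesgue ⊗ₘ κ = θhat

/-- The curve of measures `c` on `[0,1]` has derivative `m` at `u` for the weak topology induced by
the continuous functions of at most linear growth (a one-sided derivative at an endpoint). -/
def HasMeasureDerivAt (c : ℝ → Measure ℝ) (m : Measure ℝ) (u : ℝ) : Prop :=
  FiniteFirstMoment m ∧
    ∀ f : ℝ → ℝ, Continuous f → (∃ C : ℝ, ∀ x, |f x| ≤ C * (1 + |x|)) →
      HasDerivWithinAt (fun t => ∫ x, f x ∂(c t)) (∫ x, f x ∂m) (Icc 0 1) u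

/-- `x_T^- = sup (T ∩ (-∞, x])`. -/
def lowerPoint (T : Set ℝ) (x : ℝ) : ℝ := sSup (T ∩ Iic x)

/-- `x_T^+ = inf (T ∩ [x, +∞))`. -/
def upperPoint (T : Set ℝ) (x : ℝ) : ℝ := sInf (T ∩ Ici x)

open Classical in
/-- The Kellerer dilation `P_T(x, ·)`. It is meaningful for `inf T ≤ x ≤ sup T`. -/
def dilation (T : Set ℝ) (x : ℝ) : Measure ℝ :=
  if x ∈ T then Measure.dirac x
  else
    ENNReal.ofReal ((upperPoint T x - x) / (upperPoint T x - lowerPoint T x)) •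
        Measure.dirac (lowerPoint T x) +
      ENNReal.ofReal ((x - lowerPoint T x) / (upperPoint T x - lowerPoint T x)) •
        Measure.dirac (upperPoint T x)

/-- The hitting projection `m P_T`, i.e. `(m P_T)(B) = ∫ P_T(x, B) dm(x)`. -/
def hittingProjection (m : Measure ℝ) (T : Set ℝ) : Measure ℝ := m.bind (dilation T)

theorem measurable_lowerPoint (T : Set ℝ) : Measurable (lowerPoint T) := by
  set A : Set ℝ := {x | (T ∩ Iic x).Nonempty} with hA
  have hup : IsUpperSet A := fun x y hxy ⟨z, hz, hzx⟩ => ⟨z, hz, le_trans hzx hxy⟩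
  have hAm : MeasurableSet A := hup.ordConnected.measurableSet
  have := hup.ordConnected
  refine measurable_of_restrict_of_restrict_compl hAm ?_ ?_
  · refine Monotone.measurable ?_
    rintro ⟨x, hx⟩ ⟨y, hy⟩ hxy
    exact csSup_le_csSup ⟨y, fun z hz => hz.2⟩ hx
      (inter_subset_inter_right T (Iic_subset_Iic.2 hxy))
  · have h : Aᶜ.domRestrict (lowerPoint T) = fun _ => 0 := by
      funext x
      have hx : T ∩ Iic (x : ℝ) = ∅ := not_nonempty_iff_eq_empty.1 x.2
      simp [domRestrict, lowerPoint, hx]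
    rw [h]
    exact measurable_const

theorem measurable_upperPoint (T : Set ℝ) : Measurable (upperPoint T) := by
  set A : Set ℝ := {x | (T ∩ Ici x).Nonempty} with hA
  have hlo : IsLowerSet A := fun x y hyx ⟨z, hz, hzx⟩ => ⟨z, hz, le_trans hyx hzx⟩
  have hAm : MeasurableSet A := hlo.ordConnected.measurableSet
  have := hlo.ordConnected
  refine measurable_of_restrict_of_restrict_compl hAm ?_ ?_
  · refine Monotone.measurable ?_
    rintro ⟨x, hx⟩ ⟨y, hy⟩ hxy
    exact csInf_le_csInf ⟨x, fun z hz => hz.2⟩ hy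
      (inter_subset_inter_right T (Ici_subset_Ici.2 hxy))
  · have h : Aᶜ.domRestrict (upperPoint T) = fun _ => 0 := by
      funext x
      have hx : T ∩ Ici (x : ℝ) = ∅ := not_nonempty_iff_eq_empty.1 x.2
      simp [domRestrict, upperPoint, hx]
    rw [h]
    exact measurable_const

/-- `P_T` is a measurable family of measures, so that `m P_T` is given by the usual formula. -/
theorem measurable_dilation {T : Set ℝ} (hT : MeasurableSet T) : Measurable (dilation T) := by
  classical
  have h1 := measurable_lowerPoint T
  have h2 := measurable_upperPoint T
  refine Measure.measurable_of_measurable_coe _ fun s hs => ?_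
  have h : (fun x => dilation T x s) = T.piecewise (fun x => s.indicator 1 x) (fun x =>
      ENNReal.ofReal ((upperPoint T x - x) / (upperPoint T x - lowerPoint T x)) *
          s.indicator 1 (lowerPoint T x) +
        ENNReal.ofReal ((x - lowerPoint T x) / (upperPoint T x - lowerPoint T x)) *
          s.indicator 1 (upperPoint T x)) := by
    funext x
    by_cases hx : x ∈ T
    · simp [dilation, hx, hs]
    · simp [dilation, hx, hs]
  rw [h]
  have hind : Measurable (s.indicator (1 : ℝ → ENNReal)) := measurable_one.indicator hs
  refine Measurable.piecewise hT hind ?_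
  exact (((h2.sub measurable_id).div (h2.sub h1)).ennreal_ofReal.mul (hind.comp h1)).add
    (((measurable_id.sub h1).div (h2.sub h1)).ennreal_ofReal.mul (hind.comp h2))

theorem hittingProjection_apply (m : Measure ℝ) {T : Set ℝ} (hT : MeasurableSet T)
    {B : Set ℝ} (hB : MeasurableSet B) :
    hittingProjection m T B = ∫⁻ x, dilation T x B ∂m :=
  Measure.bind_apply hB (measurable_dilation hT).aemeasurable

/-- `spt m ⊆ [inf T, sup T]`, where the infimum and the supremum are extended reals. -/
def SupportWithin (m : Measure ℝ) (T : Set ℝ) : Prop :=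
  ∀ x ∈ m.support,
    sInf ((fun t : ℝ => (t : EReal)) '' T) ≤ (x : EReal) ∧
      (x : EReal) ≤ sSup ((fun t : ℝ => (t : EReal)) '' T)

/-- `πhat` is a lifted shadow coupling of `μhat` and `ν`. -/
def IsLiftedShadowCoupling (μhat : Measure (ℝ × ℝ)) (ν : Measure ℝ)
    (πhat : Measure (ℝ × ℝ × ℝ)) : Prop :=
  IsLiftedMartingalePlan μhat ν πhat ∧
    ∀ u ∈ Icc (0 : ℝ) 1,
      (primitive πhat u).fst = primitive μhat u ∧
        IsShadow ν (primitive μhat u) (primitive πhat u).snd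

/-- `T(u)`, the support of `ν - ν_{[0,u]}`, where `ν_{[0,u]}` is the second marginal of
`π_{[0,u]}`. -/
def remainingSupport (ν : Measure ℝ) (πhat : Measure (ℝ × ℝ × ℝ)) (u : ℝ) : Set ℝ :=
  (ν - (primitive πhat u).snd).support

end

end ShadowCoupling

/-! Everything is read off put functions `p_α(k) = ∫ (k - y)⁺ dα(y)`. A measure with finite first
moment is determined by its put function. A convex function that tends to `0` at `-∞` and is
asymptotic to some `m k - c` at `+∞` is the put function of a measure of mass `m` and mean `c`
(`exists_put_eq`). Convex order means equal mass, equal mean and pointwise ordered put functions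
(`convexOrder_iff`).

Let `α + ρ ≤_c σ`. The complement of any competitor for the shadow of `α` in `σ` has a put function
that is a convex minorant of `p_σ - p_α`, so the shadow should be the measure whose complement has
the greatest convex minorant as put function. Both this minorant and its difference from `p_σ` are
convex (`ConvexOn.sub_convexHullFun`) and have the right asymptotics, hence they are put functions
and the shadow exists (`exists_isShadowSplit`). Iterating the hull gives associativity: the shadow
of `α + β` is that of `α` plus the shadow of `β` in the complement (`IsShadowSplit.increment`).

Consequently `ν_[0,t] - ν_[0,u]`, for `u < t`, is the shadow of a measure of mass `t - u` in `σ = ν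
- ν_[0,u]`. If `k` lies in `T(u) = spt σ`, then `σ` has mass arbitrarily close to `k`, and at `k`
the put functions of a small measure and of its shadow differ by `o(t - u)`
(`IsShadowSplit.put_le_add`). Off `T(u)` the put function of a measure carried by `T(u)` is affine
on each gap. Thus the difference quotients of the shadow curve converge to the put function of `μ_u
P_{T(u)}` wherever `μ_u` exists (`tendsto_put_shadow`), which is almost everywhere by Lebesgue
differentiation.

Existence: the plan with disintegration `P_{T(u)}(x, ·)` has the shadows as second marginals,
because the shadow curve is Lipschitz when tested on differences of put payoffs and is therefore the
integral of its right derivative.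

Uniqueness: two lifted shadow couplings have the same law of `(u, y)`, so almost every kernel
measure of either is carried by `T(u)` and has barycenter `x`. Among such measures `P_{T(u)}(x, ·)`
is the unique minimizer of `∫ √(1 + y²)` (`dilation_minimal`); the total integral is fixed by the
marginal `ν`, so equality holds almost everywhere. -/

open Filter Topology

namespace ShadowCoupling

/-! ### Greatest convex minorants -/

section ConvexMinorant

/-- A real function is convex iff it lies below every line dominating it at two end points. -/
theorem convexOn_univ_iff_line {f : ℝ → ℝ} :
    ConvexOn ℝ univ f ↔ ∀ a b s t : ℝ, f a ≤ s * a + t → f b ≤ s * b + t →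
      ∀ x ∈ Icc a b, f x ≤ s * x + t := by
  constructor
  · intro hf a b s t ha hb x hx
    have hs : x ∈ segment ℝ a b := by rwa [segment_eq_Icc (hx.1.trans hx.2)]
    obtain ⟨p, q, hp, hq, hpq, rfl⟩ := hs
    have h := hf.2 (mem_univ a) (mem_univ b) hp hq hpq
    simp only [smul_eq_mul] at h ⊢
    have h1 := mul_le_mul_of_nonneg_left ha hp
    have h2 := mul_le_mul_of_nonneg_left hb hq
    have h3 : t = p * t + q * t := by rw [← add_mul, hpq, one_mul]
    linarith
  · intro h
    refine LinearOrder.convexOn_of_lt convex_univ fun x _ y _ hxy p q hp hq hpq => ?_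
    have hd : y - x ≠ 0 := by linarith
    set s := (f y - f x) / (y - x) with hs
    have h1 : s * (y - x) = f y - f x := div_mul_cancel₀ _ hd
    have hp' : p = 1 - q := by linarith
    subst hp'
    have := h x y s (f x - s * x) (by linarith) (by linarith) ((1 - q) • x + q • y) ⟨by
      simp only [smul_eq_mul]; nlinarith, by simp only [smul_eq_mul]; nlinarith⟩
    refine this.trans_eq ?_
    simp only [smul_eq_mul]
    linear_combination q * h1

theorem convexOn_affine (s t : ℝ) : ConvexOn ℝ univ fun x : ℝ => s * x + t :=
  convexOn_univ_iff_line.2 fun a b p q ha hb x hx => by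
    have h1 := hx.1
    have h2 := hx.2
    rcases le_total s p with h | h <;> nlinarith

/-- Replacing a convex function on an interval by its maximum with another convex function which
is smaller at the end points yields a convex function. -/
theorem _root_.ConvexOn.glue {f g : ℝ → ℝ} (hf : ConvexOn ℝ univ f) (hg : ConvexOn ℝ univ g) {a b : ℝ}
    (ha : g a ≤ f a) (hb : g b ≤ f b) :
    ConvexOn ℝ univ ((Icc a b).piecewise (fun x => max (f x) (g x)) f) := by
  classical
  set c := (Icc a b).piecewise (fun x => max (f x) (g x)) f with hc
  have hin : ∀ x ∈ Icc a b, c x = max (f x) (g x) := fun x hx => piecewise_eq_of_mem _ _ _ hx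
  have hout : ∀ x ∉ Icc a b, c x = f x := fun x hx => piecewise_eq_of_notMem _ _ _ hx
  have hfc : ∀ x, f x ≤ c x := fun x => by
    by_cases hx : x ∈ Icc a b
    · rw [hin x hx]; exact le_max_left _ _
    · rw [hout x hx]
  refine convexOn_univ_iff_line.2 fun x y s t hx hy z hz => ?_
  have hfM : ∀ w ∈ Icc x y, f w ≤ s * w + t :=
    convexOn_univ_iff_line.1 hf x y s t ((hfc x).trans hx) ((hfc y).trans hy)
  by_cases hzI : z ∈ Icc a b
  · rw [hin z hzI]
    refine max_le (hfM z hz) ?_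
    -- The chord is cut down to `[a, b]`: at a new end point `a` or `b`, `g` is below `f` and hence
    -- below the line.
    refine convexOn_univ_iff_line.1 hg (max x a) (min y b) s t ?_ ?_ z
      ⟨max_le hz.1 hzI.1, le_min hz.2 hzI.2⟩
    · rcases le_total x a with h | h
      · rw [max_eq_right h]
        exact ha.trans (hfM a ⟨h, hzI.1.trans hz.2⟩)
      · rw [max_eq_left h]
        rw [hin x ⟨h, hz.1.trans hzI.2⟩] at hx
        exact (le_max_right _ _).trans hx
    · rcases le_total y b with h | h
      · rw [min_eq_left h]
        rw [hin y ⟨hzI.1.trans hz.2, h⟩] at hy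
        exact (le_max_right _ _).trans hy
      · rw [min_eq_right h]
        exact hb.trans (hfM b ⟨hz.1.trans hzI.2, h⟩)
  · rw [hout z hzI]
    exact hfM z hz

/-- The greatest convex minorant of a function that has a convex minorant. -/
noncomputable def convexHullFun (h : ℝ → ℝ) (x : ℝ) : ℝ :=
  sSup {y | ∃ c : ℝ → ℝ, ConvexOn ℝ univ c ∧ (∀ z, c z ≤ h z) ∧ y = c x}

variable {h : ℝ → ℝ}

theorem le_convexHullFun {c : ℝ → ℝ} (hc : ConvexOn ℝ univ c) (hch : ∀ z, c z ≤ h z) (x : ℝ) :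
    c x ≤ convexHullFun h x :=
  le_csSup ⟨h x, by rintro _ ⟨d, -, hd, rfl⟩; exact hd x⟩ ⟨c, hc, hch, rfl⟩

theorem convexHullFun_le_of_forall (hex : ∃ c : ℝ → ℝ, ConvexOn ℝ univ c ∧ ∀ z, c z ≤ h z)
    {x y : ℝ} (hy : ∀ c : ℝ → ℝ, ConvexOn ℝ univ c → (∀ z, c z ≤ h z) → c x ≤ y) :
    convexHullFun h x ≤ y := by
  obtain ⟨c, hc, hch⟩ := hex
  exact csSup_le ⟨_, c, hc, hch, rfl⟩ (by rintro _ ⟨d, hd, hdh, rfl⟩; exact hy d hd hdh)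

theorem convexHullFun_le (hex : ∃ c : ℝ → ℝ, ConvexOn ℝ univ c ∧ ∀ z, c z ≤ h z) (x : ℝ) :
    convexHullFun h x ≤ h x :=
  convexHullFun_le_of_forall hex fun _ _ hc => hc x

theorem convexOn_convexHullFun (hex : ∃ c : ℝ → ℝ, ConvexOn ℝ univ c ∧ ∀ z, c z ≤ h z) :
    ConvexOn ℝ univ (convexHullFun h) :=
  convexOn_univ_iff_line.2 fun a b s t ha hb x hx =>
    convexHullFun_le_of_forall hex fun _ hc hch => convexOn_univ_iff_line.1 hc a b s t
      ((le_convexHullFun hc hch a).trans ha) ((le_convexHullFun hc hch b).trans hb) x hx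

/-- If `f` and `g` are convex, then so is the difference of `f` and the greatest convex minorant
of `f - g`. -/
theorem _root_.ConvexOn.sub_convexHullFun {f g : ℝ → ℝ} (hf : ConvexOn ℝ univ f)
    (hg : ConvexOn ℝ univ g)
    (hex : ∃ c : ℝ → ℝ, ConvexOn ℝ univ c ∧ ∀ z, c z ≤ f z - g z) :
    ConvexOn ℝ univ fun x => f x - convexHullFun (fun z => f z - g z) x := by
  classical
  set C := convexHullFun fun z => f z - g z with hC
  have hCle := convexHullFun_le hex
  have hCc := convexOn_convexHullFun hex
  refine convexOn_univ_iff_line.2 fun a b s t ha hb x hx => ?_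
  -- Let `f - C` lie below a line at `a` and `b`. Then `f - line` is below `C` there, and `g` is
  -- below the line on `[a, b]`. So raising `C` to `f - line` on `[a, b]` still gives a convex
  -- minorant of `f - g`; by maximality nothing was raised.
  have hφ : ConvexOn ℝ univ fun z => f z - (s * z + t) := by
    have := hf.add (convexOn_affine (-s) (-t))
    refine this.congr fun z _ => ?_
    simp only [Pi.add_apply]; ring
  have hgl : ∀ z ∈ Icc a b, g z ≤ s * z + t := by
    refine convexOn_univ_iff_line.1 hg a b s t ?_ ?_
    · have := hCle a; simp only [← hC] at this; linarith
    · have := hCle b; simp only [← hC] at this; linarith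
  have hglue := hCc.glue hφ (a := a) (b := b) (by simp only [← hC]; linarith)
    (by simp only [← hC]; linarith)
  have := le_convexHullFun (h := fun z => f z - g z) hglue (fun z => by
    by_cases hz : z ∈ Icc a b
    · rw [piecewise_eq_of_mem _ _ _ hz]
      exact max_le (hCle z) (by linarith [hgl z hz])
    · rw [piecewise_eq_of_notMem _ _ _ hz]
      exact hCle z) x
  rw [piecewise_eq_of_mem _ _ _ hx] at this
  have h2 := (le_max_right _ _).trans this
  simp only [← hC] at h2
  linarith

/-- If `c` is a convex minorant of `h - g`, then `c + g` is one of `h`, hence lies below the hull of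
`h`. This is the source of the associativity of shadows. -/
theorem convexHullFun_convexHullFun_sub {g : ℝ → ℝ} (hg : ConvexOn ℝ univ g)
    (hex : ∃ c : ℝ → ℝ, ConvexOn ℝ univ c ∧ ∀ z, c z ≤ h z)
    (hex' : ∃ c : ℝ → ℝ, ConvexOn ℝ univ c ∧ ∀ z, c z ≤ h z - g z) :
    convexHullFun (fun z => convexHullFun h z - g z) = convexHullFun fun z => h z - g z := by
  have key : ∀ c : ℝ → ℝ, ConvexOn ℝ univ c → (∀ z, c z ≤ h z - g z) →
      ∀ z, c z ≤ convexHullFun h z - g z := fun c hc hch z => by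
    have := le_convexHullFun (h := h) (hc.add hg)
      (fun w => by simp only [Pi.add_apply]; linarith [hch w]) z
    simp only [Pi.add_apply] at this
    linarith
  obtain ⟨d, hd, hdh⟩ := hex'
  ext x
  refine le_antisymm (convexHullFun_le_of_forall ⟨d, hd, key d hd hdh⟩ fun c hc hch =>
    le_convexHullFun hc (fun z => (hch z).trans ?_) x)
    (convexHullFun_le_of_forall ⟨d, hd, hdh⟩ fun c hc hch => le_convexHullFun hc (key c hc hch) x)
  linarith [convexHullFun_le hex z]

end ConvexMinorant

/-! ### Right derivatives of convex functions -/

section RightDerivative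

variable {f : ℝ → ℝ}

theorem _root_.ConvexOn.continuous_real (hf : ConvexOn ℝ univ f) : Continuous f :=
  continuousOn_univ.1 (hf.continuousOn isOpen_univ)

theorem _root_.ConvexOn.hasDerivWithinAt_right (hf : ConvexOn ℝ univ f) (x : ℝ) :
    HasDerivWithinAt f (derivWithin f (Ioi x) x) (Ioi x) x :=
  hf.hasDerivWithinAt_rightDeriv_of_mem_interior (by simp)

theorem _root_.ConvexOn.monotone_rightDeriv (hf : ConvexOn ℝ univ f) :
    Monotone fun x => derivWithin f (Ioi x) x := fun x y hxy =>
  hf.monotoneOn_rightDeriv (by simp) (by simp) hxy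

theorem _root_.ConvexOn.add_rightDeriv_mul_le (hf : ConvexOn ℝ univ f) (x y : ℝ) :
    f x + derivWithin f (Ioi x) x * (y - x) ≤ f y := by
  rcases lt_trichotomy x y with h | rfl | h
  · have := hf.rightDeriv_le_slope_of_mem_interior (x := x) (by simp) (mem_univ y) h
    rw [slope_def_field, le_div_iff₀ (by linarith)] at this
    linarith
  · simp
  · have h1 := hf.leftDeriv_le_rightDeriv_of_mem_interior (x := x) (by simp)
    have h2 := hf.slope_le_leftDeriv_of_mem_interior (x := y) (y := x) (mem_univ y) (by simp) h
    have := h2.trans h1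
    rw [slope_def_field, div_le_iff₀ (by linarith)] at this
    linarith

theorem _root_.ConvexOn.continuousWithinAt_rightDeriv (hf : ConvexOn ℝ univ f) (x : ℝ) :
    ContinuousWithinAt (fun x => derivWithin f (Ioi x) x) (Ici x) x := by
  rw [← continuousWithinAt_Ioi_iff_Ici]
  refine tendsto_order.2 ⟨fun a ha => ?_, fun a ha => ?_⟩
  · filter_upwards [self_mem_nhdsWithin] with y hy
    exact ha.trans_le (hf.monotone_rightDeriv (le_of_lt hy))
  · have h1 := (hasDerivWithinAt_iff_tendsto_slope' self_notMem_Ioi).1 (hf.hasDerivWithinAt_right x)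
    -- A chord from `x` to some `z > x` has slope below `a`. The slope of the chord from `y` to `z`
    -- is continuous in `y` and bounds the right derivative at `y` from above.
    obtain ⟨z, hz, hxz⟩ := ((h1.eventually_lt_const ha).and self_mem_nhdsWithin).exists
    have hxz : x < z := hxz
    rw [slope_def_field] at hz
    have h2 : ContinuousAt (fun y => (f z - f y) / (z - y)) x := by
      refine ContinuousAt.div ?_ (by fun_prop) (by linarith)
      exact continuousAt_const.sub hf.continuous_real.continuousAt
    filter_upwards [(h2.tendsto.eventually_lt_const hz).filter_mono nhdsWithin_le_nhds,
      (eventually_lt_nhds hxz).filter_mono nhdsWithin_le_nhds] with y hy hyz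
    refine lt_of_le_of_lt ?_ hy
    rw [le_div_iff₀ (by linarith)]
    linarith [hf.add_rightDeriv_mul_le y z]

/-- The right derivative of a convex function, as a Stieltjes function. -/
noncomputable def _root_.ConvexOn.stieltjes (hf : ConvexOn ℝ univ f) : StieltjesFunction ℝ where
  toFun x := derivWithin f (Ioi x) x
  mono' := hf.monotone_rightDeriv
  right_continuous' := hf.continuousWithinAt_rightDeriv

theorem _root_.ConvexOn.integral_rightDeriv (hf : ConvexOn ℝ univ f) (a b : ℝ) :
    ∫ x in a..b, derivWithin f (Ioi x) x = f b - f a :=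
  intervalIntegral.integral_eq_sub_of_hasDeriv_right hf.continuous_real.continuousOn
    (fun x _ => hf.hasDerivWithinAt_right x) (hf.monotone_rightDeriv.intervalIntegrable)

end RightDerivative

/-! ### Put functions and their characterization -/

section Put

/-- The put function `k ↦ ∫ (k - y)⁺ dα(y)` of a measure. -/
noncomputable def put (α : Measure ℝ) (k : ℝ) : ℝ := ∫ y, max (k - y) 0 ∂α

variable {α β : Measure ℝ}

theorem FiniteFirstMoment.integrable_of_le (hα : FiniteFirstMoment α) {f : ℝ → ℝ}
    (hf : Measurable f) {C : ℝ} (hC : ∀ x, |f x| ≤ C * (1 + |x|)) : Integrable f α := by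
  have := hα.1
  exact (((integrable_const (1 : ℝ)).add hα.2.abs).const_mul C).mono' hf.aestronglyMeasurable
    (ae_of_all _ fun x => by simpa using hC x)

theorem abs_max_sub_le (k x : ℝ) : |max (k - x) 0| ≤ (1 + |k|) * (1 + |x|) := by
  rw [abs_of_nonneg (le_max_right _ _)]
  refine max_le ?_ (by positivity)
  nlinarith [abs_nonneg k, abs_nonneg x, le_abs_self k, neg_abs_le x,
    mul_nonneg (abs_nonneg k) (abs_nonneg x)]

theorem abs_max_sub_le' (k x : ℝ) : |max (x - k) 0| ≤ (1 + |k|) * (1 + |x|) := by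
  have := abs_max_sub_le (-k) (-x)
  rwa [abs_neg, abs_neg, neg_sub_neg] at this

theorem FiniteFirstMoment.integrable_put (hα : FiniteFirstMoment α) (k : ℝ) :
    Integrable (fun y => max (k - y) 0) α :=
  hα.integrable_of_le (by fun_prop) (abs_max_sub_le k)

theorem FiniteFirstMoment.integrable_call (hα : FiniteFirstMoment α) (k : ℝ) :
    Integrable (fun y => max (y - k) 0) α :=
  hα.integrable_of_le (by fun_prop) (abs_max_sub_le' k)

theorem FiniteFirstMoment.mono (hα : FiniteFirstMoment α) (h : β ≤ α) : FiniteFirstMoment β := by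
  have := hα.1
  exact ⟨isFiniteMeasure_of_le α h, hα.2.mono_measure h⟩

theorem FiniteFirstMoment.add (hα : FiniteFirstMoment α) (hβ : FiniteFirstMoment β) :
    FiniteFirstMoment (α + β) := by
  have := hα.1
  have := hβ.1
  exact ⟨inferInstance, hα.2.add_measure hβ.2⟩

theorem put_add (hα : FiniteFirstMoment α) (hβ : FiniteFirstMoment β) (k : ℝ) :
    put (α + β) k = put α k + put β k :=
  integral_add_measure (hα.integrable_put k) (hβ.integrable_put k)

theorem mean_add (hα : FiniteFirstMoment α) (hβ : FiniteFirstMoment β) :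
    ∫ y, y ∂(α + β) = ∫ y, y ∂α + ∫ y, y ∂β :=
  integral_add_measure hα.2 hβ.2

theorem mass_add (hα : FiniteFirstMoment α) (hβ : FiniteFirstMoment β) :
    (α + β).real univ = α.real univ + β.real univ := by
  have := hα.1
  have := hβ.1
  exact measureReal_add_apply

theorem put_mono (hα : FiniteFirstMoment α) : Monotone (put α) := fun k l h =>
  integral_mono (hα.integrable_put k) (hα.integrable_put l) fun y =>
    max_le_max (by linarith) le_rfl

theorem put_le_put_add (hα : FiniteFirstMoment α) {k l : ℝ} (h : k ≤ l) :
    put α l ≤ put α k + α.real univ * (l - k) := by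
  have := hα.1
  have h1 : α.real univ * (l - k) = ∫ _, (l - k) ∂α := by simp
  rw [h1, put, put, ← integral_add (hα.integrable_put k) (integrable_const _)]
  refine integral_mono (hα.integrable_put l)
    ((hα.integrable_put k).add (integrable_const _)) fun y => ?_
  simp only
  exact max_le (by linarith [le_max_left (k - y) 0]) (by linarith [le_max_right (k - y) 0])

/-- Put-call parity: `(k - y)⁺ = (k - y) + (y - k)⁺`. -/
theorem put_eq_add_call (hα : FiniteFirstMoment α) (k : ℝ) :
    put α k = α.real univ * k - ∫ y, y ∂α + ∫ y, max (y - k) 0 ∂α := by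
  have := hα.1
  have h1 : α.real univ * k = ∫ _, k ∂α := by simp
  rw [h1, ← integral_sub (integrable_const _) hα.2,
    ← integral_add (f := fun y => k - y) ((integrable_const _).sub hα.2) (hα.integrable_call k),
    put]
  refine integral_congr_ae (ae_of_all _ fun y => ?_)
  simp only
  rcases le_total k y with h | h
  · rw [max_eq_right (by linarith), max_eq_left (by linarith)]; ring
  · rw [max_eq_left (by linarith), max_eq_right (by linarith)]; ring

theorem convexOn_max_sub (y : ℝ) : ConvexOn ℝ univ fun k : ℝ => max (k - y) 0 := by
  have h := (convexOn_affine 1 (-y)).sup (convexOn_affine 0 0)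
  refine h.congr fun k _ => ?_
  simp only [Pi.sup_apply]
  ring_nf

theorem convexOn_sub_max (k : ℝ) : ConvexOn ℝ univ fun y : ℝ => max (k - y) 0 := by
  have h := (convexOn_affine (-1) k).sup (convexOn_affine 0 0)
  refine h.congr fun y _ => ?_
  simp only [Pi.sup_apply]
  ring_nf

theorem convexOn_put (hα : FiniteFirstMoment α) : ConvexOn ℝ univ (put α) := by
  refine ⟨convex_univ, fun x _ y _ a b ha hb hab => ?_⟩
  simp only [put, smul_eq_mul]
  rw [← integral_const_mul, ← integral_const_mul,
    ← integral_add ((hα.integrable_put x).const_mul a) ((hα.integrable_put y).const_mul b)]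
  exact integral_mono (hα.integrable_put _)
    (((hα.integrable_put x).const_mul a).add ((hα.integrable_put y).const_mul b)) fun z =>
    (convexOn_max_sub z).2 (mem_univ x) (mem_univ y) ha hb hab

theorem tendsto_put_atBot (hα : FiniteFirstMoment α) : Tendsto (put α) atBot (𝓝 0) := by
  have h0 : (0 : ℝ) = ∫ _, 0 ∂α := by simp
  rw [h0]
  refine tendsto_integral_filter_of_dominated_convergence (fun y => |y|)
    (Eventually.of_forall fun k => (hα.integrable_put k).1) ?_ hα.2.abs
    (ae_of_all _ fun y => ?_)
  · filter_upwards [eventually_le_atBot 0] with k hk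
    refine ae_of_all _ fun y => ?_
    rw [Real.norm_eq_abs, abs_of_nonneg (le_max_right _ _)]
    exact max_le (by linarith [neg_abs_le y]) (abs_nonneg y)
  · refine tendsto_const_nhds.congr' ?_
    filter_upwards [eventually_le_atBot y] with k hk
    rw [max_eq_right (by linarith)]

theorem tendsto_put_atTop (hα : FiniteFirstMoment α) :
    Tendsto (fun k => put α k - (α.real univ * k - ∫ y, y ∂α)) atTop (𝓝 0) := by
  have h0 : (0 : ℝ) = ∫ _, 0 ∂α := by simp
  have h1 : (fun k => put α k - (α.real univ * k - ∫ y, y ∂α)) =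
      fun k => ∫ y, max (y - k) 0 ∂α := by
    funext k; rw [put_eq_add_call hα]; ring
  rw [h0, h1]
  refine tendsto_integral_filter_of_dominated_convergence (fun y => |y|)
    (Eventually.of_forall fun k => (hα.integrable_call k).1) ?_ hα.2.abs
    (ae_of_all _ fun y => ?_)
  · filter_upwards [eventually_ge_atTop 0] with k hk
    refine ae_of_all _ fun y => ?_
    rw [Real.norm_eq_abs, abs_of_nonneg (le_max_right _ _)]
    exact max_le (by linarith [le_abs_self y]) (abs_nonneg y)
  · refine tendsto_const_nhds.congr' ?_
    filter_upwards [eventually_ge_atTop y] with k hk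
    rw [max_eq_right (by linarith)]

theorem abs_max_sub_max_le_abs_sub (k l y : ℝ) : |max (k - y) 0 - max (l - y) 0| ≤ |k - l| := by
  simpa using abs_max_sub_max_le_abs (k - y) (l - y) 0

/-- The difference of two put payoffs is bounded, so no first moment is needed. This matters for the
second marginals of the constructed plan before they are identified. -/
theorem integrable_max_sub_max [IsFiniteMeasure α] (k l : ℝ) :
    Integrable (fun y => max (k - y) 0 - max (l - y) 0) α :=
  (integrable_const |k - l|).mono' (by fun_prop)
    (ae_of_all _ fun y => abs_max_sub_max_le_abs_sub k l y)

/-- The difference quotients of the payoff in the strike are bounded by `1` and converge to the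
indicator of `y ≤ x`: the right derivative of a put function is the distribution function. -/
theorem tendsto_integral_slope [IsFiniteMeasure α] (x : ℝ) :
    Tendsto (fun n : ℕ => ((n : ℝ) + 1) *
      ∫ y, (max (x + 1 / ((n : ℝ) + 1) - y) 0 - max (x - y) 0) ∂α) atTop
      (𝓝 (α.real (Iic x))) := by
  rw [← integral_indicator_one measurableSet_Iic]
  simp_rw [← integral_const_mul]
  refine tendsto_integral_of_dominated_convergence (fun _ => 1) (fun n => by fun_prop)
    (integrable_const _) (fun n => ae_of_all _ fun y => ?_) (ae_of_all _ fun y => ?_)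
  · have hn : (0 : ℝ) < (n : ℝ) + 1 := by positivity
    have hp : 0 < 1 / ((n : ℝ) + 1) := by positivity
    have h2 : |max (x + 1 / ((n : ℝ) + 1) - y) 0 - max (x - y) 0| ≤ 1 / ((n : ℝ) + 1) := by
      refine (abs_max_sub_max_le_abs_sub _ _ _).trans ?_
      rw [add_sub_cancel_left, abs_of_pos hp]
    rw [Real.norm_eq_abs, abs_mul, abs_of_pos hn]
    calc _ ≤ ((n : ℝ) + 1) * (1 / ((n : ℝ) + 1)) := by gcongr
      _ = 1 := by field_simp
  · by_cases hy : y ≤ x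
    · rw [indicator_of_mem (show y ∈ Iic x from hy)]
      refine tendsto_const_nhds.congr fun n => ?_
      have hn : (0 : ℝ) < (n : ℝ) + 1 := by positivity
      have hp : 0 < 1 / ((n : ℝ) + 1) := by positivity
      rw [max_eq_left (by linarith), max_eq_left (by linarith)]
      simp only [Pi.one_apply]
      field_simp
      ring
    · rw [indicator_of_notMem (show y ∉ Iic x from hy)]
      push Not at hy
      have h3 := tendsto_one_div_add_atTop_nhds_zero_nat (𝕜 := ℝ)
      refine tendsto_const_nhds.congr' ?_
      filter_upwards [h3.eventually_lt_const (sub_pos.2 hy)] with n hn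
      rw [max_eq_right (by linarith), max_eq_right (by linarith)]
      simp

/-- A finite measure is determined by the increments of its put function. -/
theorem eq_of_integral_max_sub_max [IsFiniteMeasure α] [IsFiniteMeasure β]
    (h : ∀ k l, ∫ y, (max (k - y) 0 - max (l - y) 0) ∂α =
      ∫ y, (max (k - y) 0 - max (l - y) 0) ∂β) : α = β := by
  refine Measure.ext_of_Iic α β fun x => ?_
  have h1 := tendsto_integral_slope (α := α) x
  simp_rw [h] at h1
  exact (measureReal_eq_measureReal_iff).1 (tendsto_nhds_unique h1 (tendsto_integral_slope x))

theorem eq_of_put (hα : FiniteFirstMoment α) (hβ : FiniteFirstMoment β)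
    (h : ∀ k, put α k = put β k) : α = β := by
  have := hα.1
  have := hβ.1
  refine eq_of_integral_max_sub_max fun k l => ?_
  rw [integral_sub (hα.integrable_put k) (hα.integrable_put l),
    integral_sub (hβ.integrable_put k) (hβ.integrable_put l)]
  exact congrArg₂ _ (h k) (h l)

/-- Here `G` plays the role of the tail function of `f`; a finite improper integral of `G` yields
integrability together with the value. -/
theorem integrable_and_integral_eq_of_layercake {f G : ℝ → ℝ} {I : ℝ} (hf : Measurable f)
    (hf0 : ∀ y, 0 ≤ f y) (hG0 : ∀ t, 0 ≤ G t) (hG : ∀ a b, IntervalIntegrable G volume a b)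
    (h : ∫⁻ y, ENNReal.ofReal (f y) ∂α = ∫⁻ t in Ioi 0, ENNReal.ofReal (G t))
    (hI : Tendsto (fun n => ∫ t in (0 : ℝ)..n, G t) atTop (𝓝 I)) :
    Integrable f α ∧ ∫ y, f y ∂α = I := by
  have hint : IntegrableOn G (Ioi 0) := by
    refine integrableOn_Ioi_of_intervalIntegral_norm_tendsto I 0 (l := atTop) (b := id)
      (fun n => ?_) tendsto_id ?_
    · rcases le_total 0 n with hn | hn
      · exact (hG 0 n).1
      · simp [hn]
    · simpa [abs_of_nonneg (hG0 _)] using hI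
  have hIeq : ∫ t in Ioi 0, G t = I :=
    tendsto_nhds_unique (intervalIntegral_tendsto_integral_Ioi 0 hint tendsto_id) hI
  have h2 : ∫⁻ t in Ioi 0, ENNReal.ofReal (G t) = ENNReal.ofReal I := by
    rw [← hIeq, ofReal_integral_eq_lintegral_ofReal hint (ae_of_all _ hG0)]
  have hI0 : 0 ≤ I := hIeq ▸ integral_nonneg hG0
  have hfi : Integrable f α := by
    refine ⟨hf.aestronglyMeasurable, ?_⟩
    rw [hasFiniteIntegral_iff_ofReal (ae_of_all _ hf0), h, h2]
    exact ENNReal.ofReal_lt_top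
  refine ⟨hfi, ?_⟩
  rw [integral_eq_lintegral_of_nonneg_ae (ae_of_all _ hf0) hfi.1, h, h2, ENNReal.toReal_ofReal hI0]

/-- A convex function with the asymptotics of a put function is a put function. -/
theorem exists_put_eq {W : ℝ → ℝ} {m c : ℝ} (hW : ConvexOn ℝ univ W)
    (hbot : Tendsto W atBot (𝓝 0)) (htop : Tendsto (fun x => W x - (m * x - c)) atTop (𝓝 0)) :
    ∃ η : Measure ℝ, FiniteFirstMoment η ∧ (∀ k, put η k = W k) ∧ η.real univ = m ∧
      ∫ y, y ∂η = c := by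
  set F : ℝ → ℝ := fun x => derivWithin W (Ioi x) x with hF
  -- Support lines squeeze `F` between two unit increments of `W`, whose limits are `0` at `-∞` and
  -- `m` at `+∞`.
  have hup : ∀ x, F x ≤ W (x + 1) - W x := fun x => by
    have := hW.add_rightDeriv_mul_le x (x + 1); simp only [hF]; linarith
  have hdn : ∀ x, W x - W (x - 1) ≤ F x := fun x => by
    have := hW.add_rightDeriv_mul_le x (x - 1); simp only [hF]; linarith
  have hmono : Monotone F := hW.monotone_rightDeriv
  have hFbot : Tendsto F atBot (𝓝 0) := by
    refine tendsto_of_tendsto_of_tendsto_of_le_of_le ?_ ?_ hdn hup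
    · simpa [← sub_eq_add_neg] using
        hbot.sub (hbot.comp (tendsto_atBot_add_const_right _ (-1) tendsto_id))
    · simpa using (hbot.comp (tendsto_atBot_add_const_right _ 1 tendsto_id)).sub hbot
  have hFtop : Tendsto F atTop (𝓝 m) := by
    refine tendsto_of_tendsto_of_tendsto_of_le_of_le ?_ ?_ hdn hup
    · have := (htop.sub (htop.comp (tendsto_atTop_add_const_right _ (-1) tendsto_id))).add_const m
      simp only [sub_zero, zero_add] at this
      refine this.congr fun x => ?_
      simp only [Function.comp, id, ← sub_eq_add_neg]; ring
    · have := ((htop.comp (tendsto_atTop_add_const_right _ 1 tendsto_id)).sub htop).add_const m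
      simp only [sub_zero, zero_add] at this
      refine this.congr fun x => ?_
      simp only [Function.comp, id]; ring
  have hF0 : ∀ x, 0 ≤ F x := fun x => hmono.le_of_tendsto hFbot x
  have hFm : ∀ x, F x ≤ m := fun x => hmono.ge_of_tendsto hFtop x
  have hm0 : 0 ≤ m := (hF0 0).trans (hFm 0)
  set η := hW.stieltjes.measure with hη
  have hIic : ∀ x, η (Iic x) = ENNReal.ofReal (F x) := fun x => by
    rw [hη, hW.stieltjes.measure_Iic (l := 0) hFbot, sub_zero]; rfl
  have hIoi : ∀ x, η (Ioi x) = ENNReal.ofReal (m - F x) := fun x =>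
    hW.stieltjes.measure_Ioi hFtop x
  have huniv : η univ = ENNReal.ofReal m := by
    rw [hη, hW.stieltjes.measure_univ hFbot hFtop, sub_zero]
  have hfin : IsFiniteMeasure η := hW.stieltjes.isFiniteMeasure hFbot hFtop
  have hput : ∀ k, Integrable (fun y => max (k - y) 0) η ∧ ∫ y, max (k - y) 0 ∂η = W k := by
    intro k
    refine integrable_and_integral_eq_of_layercake (G := fun t => F (k - t)) (by fun_prop)
      (fun _ => le_max_right _ _) (fun t => hF0 _)
      (fun a b => (hmono.comp_antitone fun x y h => by linarith).intervalIntegrable) ?_ ?_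
    · rw [lintegral_eq_lintegral_meas_le (f := fun y => max (k - y) 0) _
        (ae_of_all _ fun _ => le_max_right _ _) (by fun_prop)]
      refine setLIntegral_congr_fun measurableSet_Ioi fun t ht => ?_
      rw [← hIic]
      congr 1
      ext y
      have ht : 0 < t := ht
      simp only [mem_ofPred_eq, mem_Iic, le_max_iff, ht.not_ge, or_false]
      constructor <;> intro <;> linarith
    · have : ∀ n, ∫ t in (0 : ℝ)..n, F (k - t) = W k - W (k - n) := fun n => by
        rw [intervalIntegral.integral_comp_sub_left (fun x => F x), hW.integral_rightDeriv, sub_zero]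
      simp_rw [this]
      have h2 : Tendsto (fun n : ℝ => k - n) atTop atBot :=
        tendsto_atBot_add_const_left _ k tendsto_neg_atTop_atBot
      simpa using (hbot.comp h2).const_sub (W k)
  have hcall : Integrable (fun y => max y 0) η ∧ ∫ y, max y 0 ∂η = W 0 + c := by
    refine integrable_and_integral_eq_of_layercake (G := fun t => m - F t) (by fun_prop)
      (fun _ => le_max_right _ _) (fun t => sub_nonneg.2 (hFm _))
      (fun a b => intervalIntegrable_const.sub hmono.intervalIntegrable) ?_ ?_
    · rw [lintegral_eq_lintegral_meas_lt (f := fun y => max y 0) _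
        (ae_of_all _ fun _ => le_max_right _ _) (by fun_prop)]
      refine setLIntegral_congr_fun measurableSet_Ioi fun t ht => ?_
      rw [← hIoi]
      congr 1
      ext y
      have ht : 0 < t := ht
      simp only [mem_ofPred_eq, mem_Ioi, lt_max_iff, ht.not_gt, or_false]
    · have : ∀ n, ∫ t in (0 : ℝ)..n, (m - F t) = (W 0 + c) - (W n - (m * n - c)) := fun n => by
        rw [intervalIntegral.integral_sub intervalIntegrable_const hmono.intervalIntegrable,
          hW.integral_rightDeriv, intervalIntegral.integral_const, smul_eq_mul]
        ring
      simp_rw [this]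
      simpa using htop.const_sub (W 0 + c)
  -- The first moment is the call at `0` minus the put at `0`, that is `(W 0 + c) - W 0 = c`.
  have hid : (fun y : ℝ => y) = fun y => max y 0 - max (0 - y) 0 := by
    funext y
    rcases le_total 0 y with h | h
    · rw [max_eq_left h, max_eq_right (by linarith), sub_zero]
    · rw [max_eq_right h, max_eq_left (by linarith)]; ring
  refine ⟨η, ⟨hfin, ?_⟩, fun k => (hput k).2, ?_, ?_⟩
  · rw [hid]
    exact hcall.1.sub (hput 0).1
  · rw [Measure.real, huniv, ENNReal.toReal_ofReal hm0]
  · rw [hid, integral_sub hcall.1 (hput 0).1, hcall.2, (hput 0).2]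
    ring

end Put

/-! ### Convex order through put functions -/

section ConvexOrder

theorem setLIntegral_Ioi_ofReal {G : ℝ → ℝ} {b : ℝ} (hb : 0 ≤ b)
    (hG : IntervalIntegrable G volume 0 b) (h0 : ∀ t ∈ Ioc 0 b, 0 ≤ G t) (h1 : ∀ t, b < t → G t ≤ 0) :
    ∫⁻ t in Ioi 0, ENNReal.ofReal (G t) = ENNReal.ofReal (∫ t in (0 : ℝ)..b, G t) := by
  rw [intervalIntegral.integral_of_le hb, ofReal_integral_eq_lintegral_ofReal hG.1
    ((ae_restrict_iff' measurableSet_Ioc).2 (ae_of_all _ h0)), ← Ioc_union_Ioi_eq_Ioi hb,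
    lintegral_union measurableSet_Ioi (Ioc_disjoint_Ioi le_rfl)]
  rw [setLIntegral_congr_fun (g := fun _ => 0) measurableSet_Ioi fun t ht =>
    ENNReal.ofReal_of_nonpos (h1 t ht)]
  simp

/-- A convex function is the sum of a support line and a mixture of put and call functions. -/
theorem _root_.ConvexOn.ofReal_sub_eq_lintegral {φ : ℝ → ℝ} (hφ : ConvexOn ℝ univ φ) (x : ℝ) :
    ENNReal.ofReal (φ x - (φ 0 + derivWithin φ (Ioi 0) 0 * x)) =
      ∫⁻ k in Ioi 0, ENNReal.ofReal (max (x - k) 0) ∂hφ.stieltjes.measure +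
        ∫⁻ k in Iic 0, ENNReal.ofReal (max (k - x) 0) ∂hφ.stieltjes.measure := by
  set F : ℝ → ℝ := fun x => derivWithin φ (Ioi x) x with hF
  have hmono : Monotone F := hφ.monotone_rightDeriv
  set γ := hφ.stieltjes.measure with hγ
  have hIoc : ∀ a b, γ (Ioc a b) = ENNReal.ofReal (F b - F a) :=
    fun a b => hφ.stieltjes.measure_Ioc a b
  have hi : ∀ a b, IntervalIntegrable F volume a b := fun a b => hmono.intervalIntegrable
  rcases le_total 0 x with hx | hx
  · have h2 : ∫⁻ k in Iic 0, ENNReal.ofReal (max (k - x) 0) ∂γ = 0 := by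
      rw [setLIntegral_congr_fun (g := fun _ => 0) measurableSet_Iic fun k hk => ?_]
      · simp
      · have hk : k ≤ 0 := hk
        simp only [max_eq_right (show k - x ≤ 0 by linarith), ENNReal.ofReal_zero]
    rw [h2, add_zero, lintegral_eq_lintegral_meas_le (f := fun k => max (x - k) 0) _
      (ae_of_all _ fun _ => le_max_right _ _) (by fun_prop)]
    have h3 : ∀ t ∈ Ioi (0 : ℝ), (γ.restrict (Ioi 0)) {k | t ≤ max (x - k) 0} =
        ENNReal.ofReal (F (x - t) - F 0) := fun t ht => by
      rw [← hIoc, Measure.restrict_apply (measurableSet_le (by fun_prop) (by fun_prop))]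
      congr 1
      ext k
      have ht : 0 < t := ht
      simp only [mem_inter_iff, mem_ofPred_eq, le_max_iff, ht.not_ge, or_false, mem_Ioi, mem_Ioc]
      constructor <;> rintro ⟨_, _⟩ <;> constructor <;> linarith
    rw [setLIntegral_congr_fun measurableSet_Ioi h3, setLIntegral_Ioi_ofReal hx]
    · congr 1
      rw [intervalIntegral.integral_sub, intervalIntegral.integral_comp_sub_left (fun x => F x),
        hφ.integral_rightDeriv, intervalIntegral.integral_const]
      · simp only [hF, sub_zero, sub_self, smul_eq_mul]; ring
      · exact (hmono.comp_antitone fun x y h => by linarith).intervalIntegrable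
      · exact intervalIntegrable_const
    · exact (hmono.comp_antitone fun x y h => by linarith).intervalIntegrable.sub
        intervalIntegrable_const
    · exact fun t ht => sub_nonneg.2 (hmono (by linarith [ht.2]))
    · exact fun t ht => sub_nonpos.2 (hmono (by linarith))
  · have h2 : ∫⁻ k in Ioi 0, ENNReal.ofReal (max (x - k) 0) ∂γ = 0 := by
      rw [setLIntegral_congr_fun (g := fun _ => 0) measurableSet_Ioi fun k hk => ?_]
      · simp
      · have hk : 0 < k := hk
        simp only [max_eq_right (show x - k ≤ 0 by linarith), ENNReal.ofReal_zero]
    rw [h2, zero_add, lintegral_eq_lintegral_meas_lt (f := fun k => max (k - x) 0) _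
      (ae_of_all _ fun _ => le_max_right _ _) (by fun_prop)]
    have h3 : ∀ t ∈ Ioi (0 : ℝ), (γ.restrict (Iic 0)) {k | t < max (k - x) 0} =
        ENNReal.ofReal (F 0 - F (x + t)) := fun t ht => by
      rw [← hIoc, Measure.restrict_apply (measurableSet_lt (by fun_prop) (by fun_prop))]
      congr 1
      ext k
      have ht : 0 < t := ht
      simp only [mem_inter_iff, mem_ofPred_eq, lt_max_iff, ht.not_gt, or_false, mem_Iic, mem_Ioc]
      constructor <;> rintro ⟨_, _⟩ <;> constructor <;> linarith
    rw [setLIntegral_congr_fun measurableSet_Ioi h3, setLIntegral_Ioi_ofReal (neg_nonneg.2 hx)]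
    · congr 1
      rw [intervalIntegral.integral_sub, intervalIntegral.integral_comp_add_left (fun x => F x),
        hφ.integral_rightDeriv, intervalIntegral.integral_const]
      · simp only [hF, add_zero, add_neg_cancel, smul_eq_mul]; ring
      · exact intervalIntegrable_const
      · exact (hmono.comp fun x y h => by linarith).intervalIntegrable
    · exact intervalIntegrable_const.sub (hmono.comp fun x y h => by linarith).intervalIntegrable
    · exact fun t ht => sub_nonneg.2 (hmono (by linarith [ht.2]))
    · exact fun t ht => sub_nonpos.2 (hmono (by linarith))

variable {α β : Measure ℝ}

/-- By Tonelli in the decomposition of `φ` into puts and calls it suffices to compare these. Equal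
mass and mean turn the put inequality into the call inequality by parity. -/
theorem lintegral_convex_le (hα : FiniteFirstMoment α) (hβ : FiniteFirstMoment β)
    (hmass : α.real univ = β.real univ) (hmean : ∫ y, y ∂α = ∫ y, y ∂β)
    (hput : ∀ k, put α k ≤ put β k) {φ : ℝ → ℝ} (hφ : ConvexOn ℝ univ φ) :
    ∫⁻ x, ENNReal.ofReal (φ x - (φ 0 + derivWithin φ (Ioi 0) 0 * x)) ∂α ≤
      ∫⁻ x, ENNReal.ofReal (φ x - (φ 0 + derivWithin φ (Ioi 0) 0 * x)) ∂β := by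
  have := hα.1
  have := hβ.1
  simp_rw [hφ.ofReal_sub_eq_lintegral]
  have hcall : ∀ θ : Measure ℝ, IsFiniteMeasure θ →
      ∫⁻ x, ∫⁻ k in Ioi 0, ENNReal.ofReal (max (x - k) 0) ∂hφ.stieltjes.measure ∂θ =
        ∫⁻ k in Ioi 0, ∫⁻ x, ENNReal.ofReal (max (x - k) 0) ∂θ ∂hφ.stieltjes.measure :=
    fun θ _ => lintegral_lintegral_swap (by fun_prop)
  have hput' : ∀ θ : Measure ℝ, IsFiniteMeasure θ →
      ∫⁻ x, ∫⁻ k in Iic 0, ENNReal.ofReal (max (k - x) 0) ∂hφ.stieltjes.measure ∂θ =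
        ∫⁻ k in Iic 0, ∫⁻ x, ENNReal.ofReal (max (k - x) 0) ∂θ ∂hφ.stieltjes.measure :=
    fun θ _ => lintegral_lintegral_swap (by fun_prop)
  rw [lintegral_add_left (by fun_prop), lintegral_add_left (by fun_prop), hcall α hα.1,
    hcall β hβ.1, hput' α hα.1, hput' β hβ.1]
  refine add_le_add (lintegral_mono fun k => ?_) (lintegral_mono fun k => ?_)
  · rw [← ofReal_integral_eq_lintegral_ofReal (hα.integrable_call k)
        (ae_of_all _ fun _ => le_max_right _ _),
      ← ofReal_integral_eq_lintegral_ofReal (hβ.integrable_call k)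
        (ae_of_all _ fun _ => le_max_right _ _)]
    refine ENNReal.ofReal_le_ofReal ?_
    have := hput k
    rw [put_eq_add_call hα, put_eq_add_call hβ, hmass, hmean] at this
    linarith
  · rw [← ofReal_integral_eq_lintegral_ofReal (hα.integrable_put k)
        (ae_of_all _ fun _ => le_max_right _ _),
      ← ofReal_integral_eq_lintegral_ofReal (hβ.integrable_put k)
        (ae_of_all _ fun _ => le_max_right _ _)]
    exact ENNReal.ofReal_le_ofReal (hput k)

/-- The convex order in terms of put functions. -/
theorem convexOrder_iff : ConvexOrder α β ↔ FiniteFirstMoment α ∧ FiniteFirstMoment β ∧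
    α.real univ = β.real univ ∧ ∫ y, y ∂α = ∫ y, y ∂β ∧ ∀ k, put α k ≤ put β k := by
  refine ⟨fun ⟨hα, hβ, h⟩ => ⟨hα, hβ, ?_, ?_, ?_⟩, fun ⟨hα, hβ, hmass, hmean, hput⟩ =>
    ⟨hα, hβ, fun φ hφ hi => ?_⟩⟩
  · have := hα.1
    have := hβ.1
    have h1 := (h (fun _ => 1) (convexOn_const 1 convex_univ) (integrable_const 1)).2
    have h2 := (h (fun _ => -1) (convexOn_const (-1) convex_univ) (integrable_const _)).2
    simp only [integral_const, smul_eq_mul, mul_one, mul_neg] at h1 h2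
    linarith
  · have h1 := (h (fun x => x) (convexOn_id convex_univ) hβ.2).2
    have h2 := (h (fun x => -x) ((concaveOn_id convex_univ).neg) hβ.2.neg).2
    rw [integral_neg, integral_neg] at h2
    linarith
  · exact fun k => (h _ (convexOn_sub_max k) (hβ.integrable_put k)).2
  · have := hα.1
    have := hβ.1
    set d := derivWithin φ (Ioi 0) 0
    have hψ0 : ∀ x, 0 ≤ φ x - (φ 0 + d * x) := fun x => by
      have := hφ.add_rightDeriv_mul_le 0 x
      rw [sub_zero] at this
      linarith
    have hm : Measurable φ := hφ.continuous_real.measurable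
    have hlα : Integrable (fun x => φ 0 + d * x) α := (integrable_const _).add (hα.2.const_mul d)
    have hlβ : Integrable (fun x => φ 0 + d * x) β := (integrable_const _).add (hβ.2.const_mul d)
    have hψβ : Integrable (fun x => φ x - (φ 0 + d * x)) β := hi.sub hlβ
    have hle := lintegral_convex_le hα hβ hmass hmean hput hφ
    have hψα : Integrable (fun x => φ x - (φ 0 + d * x)) α := by
      refine ⟨by fun_prop, ?_⟩
      rw [hasFiniteIntegral_iff_ofReal (ae_of_all _ hψ0)]
      refine hle.trans_lt ?_
      rw [← ofReal_integral_eq_lintegral_ofReal hψβ (ae_of_all _ hψ0)]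
      exact ENNReal.ofReal_lt_top
    have hφα : Integrable φ α := by
      refine (hψα.add hlα).congr (ae_of_all _ fun x => ?_)
      simp
    refine ⟨hφα, ?_⟩
    rw [← ofReal_integral_eq_lintegral_ofReal hψβ (ae_of_all _ hψ0),
      ← ofReal_integral_eq_lintegral_ofReal hψα (ae_of_all _ hψ0),
      ENNReal.ofReal_le_ofReal_iff (integral_nonneg hψ0), integral_sub hφα hlα,
      integral_sub hi hlβ, integral_add (integrable_const _) (hα.2.const_mul d),
      integral_add (integrable_const _) (hβ.2.const_mul d), integral_const, integral_const,
      integral_const_mul, integral_const_mul, hmass, hmean] at hle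
    linarith

end ConvexOrder

/-! ### Existence and associativity of shadows -/

section Shadow

variable {ν α η η' σ τ : Measure ℝ}

theorem IsShadow.unique (h : IsShadow ν α η) (h' : IsShadow ν α η') : η = η' := by
  obtain ⟨h1, h2, -, -, h3⟩ := convexOrder_iff.1 (h.2.2 η' h'.1 h'.2.1)
  obtain ⟨-, -, -, -, h4⟩ := convexOrder_iff.1 (h'.2.2 η h.1 h.2.1)
  exact eq_of_put h1 h2 fun k => le_antisymm (h3 k) (h4 k)

/-- `η` and `τ` are the shadow of `α` in `σ` and its complement, described by the put functions. -/
structure IsShadowSplit (σ α η τ : Measure ℝ) : Prop where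
  add_eq : η + τ = σ
  order : ConvexOrder α η
  remaining : FiniteFirstMoment τ
  put_remaining : ∀ k, put τ k = convexHullFun (fun z => put σ z - put α z) k

theorem IsShadowSplit.put_add_put (h : IsShadowSplit σ α η τ) (k : ℝ) :
    put η k + put τ k = put σ k := by
  rw [← h.add_eq, put_add h.order.2.1 h.remaining]

theorem IsShadowSplit.finiteFirstMoment (h : IsShadowSplit σ α η τ) : FiniteFirstMoment σ :=
  h.add_eq ▸ h.order.2.1.add h.remaining

theorem IsShadowSplit.mass_eq (h : IsShadowSplit σ α η τ) : α.real univ = η.real univ :=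
  (convexOrder_iff.1 h.order).2.2.1

theorem IsShadowSplit.mean_eq (h : IsShadowSplit σ α η τ) : ∫ y, y ∂α = ∫ y, y ∂η :=
  (convexOrder_iff.1 h.order).2.2.2.1

theorem IsShadowSplit.put_le (h : IsShadowSplit σ α η τ) (k : ℝ) : put α k ≤ put η k :=
  (convexOrder_iff.1 h.order).2.2.2.2 k

theorem IsShadowSplit.le (h : IsShadowSplit σ α η τ) : η ≤ σ :=
  h.add_eq ▸ Measure.le_add_right le_rfl

theorem IsShadowSplit.exists_minorant (h : IsShadowSplit σ α η τ) :
    ∃ c : ℝ → ℝ, ConvexOn ℝ univ c ∧ ∀ z, c z ≤ put σ z - put α z :=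
  ⟨put τ, convexOn_put h.remaining, fun z => by linarith [h.put_add_put z, h.put_le z]⟩

theorem IsShadowSplit.isShadow (h : IsShadowSplit σ α η τ) : IsShadow σ α η := by
  refine ⟨h.order, h.le, fun η' h1 h2 => ?_⟩
  have hσ := h.finiteFirstMoment
  have hη' := h1.2.1
  obtain ⟨-, -, e1, e2, e3⟩ := convexOrder_iff.1 h1
  have := hη'.1
  have := hσ.1
  have hsub : FiniteFirstMoment (σ - η') := hσ.mono Measure.sub_le
  have hadd : σ - η' + η' = σ := Measure.sub_add_cancel_of_le h2
  have hput : ∀ k, put (σ - η') k + put η' k = put σ k := fun k => by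
    rw [← put_add hsub hη', hadd]
  refine convexOrder_iff.2 ⟨h.order.2.1, hη', h.mass_eq.symm.trans e1, h.mean_eq.symm.trans e2,
    fun k => ?_⟩
  -- Since `put α ≤ put η'`, the put function of the complement `σ - η'` is a convex minorant of
  -- `put σ - put α`, hence below `put τ`; passing to complements reverses the inequality.
  have := le_convexHullFun (h := fun z => put σ z - put α z) (convexOn_put hsub)
    (fun z => by linarith [hput z, e3 z]) k
  rw [← h.put_remaining] at this
  linarith [h.put_add_put k, hput k]

variable {ρ : Measure ℝ}

/-- If `α + ρ` is smaller than `σ` in convex order, then `α` has a shadow in `σ`, and `ρ` is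
smaller than its complement in convex order. -/
theorem exists_isShadowSplit (hα : FiniteFirstMoment α) (hρ : FiniteFirstMoment ρ)
    (h : ConvexOrder (α + ρ) σ) : ∃ η τ, IsShadowSplit σ α η τ ∧ ConvexOrder ρ τ := by
  obtain ⟨-, hσ, hmass, hmean, hput⟩ := convexOrder_iff.1 h
  rw [mass_add hα hρ] at hmass
  rw [mean_add hα hρ] at hmean
  simp_rw [put_add hα hρ] at hput
  have hex : ∃ c : ℝ → ℝ, ConvexOn ℝ univ c ∧ ∀ z, c z ≤ put σ z - put α z :=
    ⟨put ρ, convexOn_put hρ, fun z => by linarith [hput z]⟩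
  set C := convexHullFun fun z => put σ z - put α z with hC
  have hCc : ConvexOn ℝ univ C := convexOn_convexHullFun hex
  have hle : ∀ k, C k ≤ put σ k - put α k := convexHullFun_le hex
  have hge : ∀ k, put ρ k ≤ C k := le_convexHullFun (convexOn_put hρ) fun z => by linarith [hput z]
  -- The hull lies between `put ρ` and `put σ - put α`, which have the same asymptotics at both
  -- ends; this fixes the mass and the mean of the complement.
  have hbot : Tendsto C atBot (𝓝 0) := by
    refine tendsto_of_tendsto_of_tendsto_of_le_of_le (tendsto_put_atBot hρ) ?_ hge hle
    simpa using (tendsto_put_atBot hσ).sub (tendsto_put_atBot hα)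
  have htop : Tendsto (fun k => C k - (ρ.real univ * k - ∫ y, y ∂ρ)) atTop (𝓝 0) := by
    refine tendsto_of_tendsto_of_tendsto_of_le_of_le (tendsto_put_atTop hρ)
      (h := fun k => (put σ k - (σ.real univ * k - ∫ y, y ∂σ)) -
        (put α k - (α.real univ * k - ∫ y, y ∂α))) ?_ (fun k => ?_) fun k => ?_
    · simpa using (tendsto_put_atTop hσ).sub (tendsto_put_atTop hα)
    · exact sub_le_sub_right (hge k) _
    · simp only
      rw [← hmass, ← hmean]
      linarith [hle k]
  obtain ⟨τ, hτ, hτC, hτm, hτc⟩ := exists_put_eq hCc hbot htop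
  obtain ⟨η, hη, hηC, hηm, hηc⟩ := exists_put_eq (m := α.real univ) (c := ∫ y, y ∂α)
    ((convexOn_put hσ).sub_convexHullFun (convexOn_put hα) hex)
    (by simpa using (tendsto_put_atBot hσ).sub hbot)
    (by
      have := (tendsto_put_atTop hσ).sub htop
      rw [sub_zero] at this
      refine this.congr fun k => ?_
      rw [← hmass, ← hmean]
      ring)
  refine ⟨η, τ, ⟨?_, convexOrder_iff.2 ⟨hα, hη, hηm.symm, hηc.symm, fun k => ?_⟩, hτ, hτC⟩,
    convexOrder_iff.2 ⟨hρ, hτ, hτm.symm, hτc.symm, fun k => ?_⟩⟩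
  · refine eq_of_put (hη.add hτ) hσ fun k => ?_
    rw [put_add hη hτ, hηC, hτC]
    ring
  · rw [hηC]
    linarith [hle k]
  · rw [hτC]
    exact hge k

/-- Shadows are associative: the shadow of `α + β` arises from that of `α` by adding the shadow of
`β` in the complement. -/
theorem IsShadowSplit.increment {β η₂ τ₂ : Measure ℝ} (h : IsShadowSplit σ α η τ)
    (hβ : FiniteFirstMoment β) (hρ : FiniteFirstMoment ρ) (hβρ : ConvexOrder (β + ρ) τ)
    (h₂ : IsShadowSplit σ (α + β) η₂ τ₂) :
    ∃ δ, IsShadowSplit τ β δ τ₂ ∧ η + δ = η₂ := by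
  obtain ⟨δ, τ', hδ, -⟩ := exists_isShadowSplit hβ hρ hβρ
  have hα := h.order.1
  -- The complement of the second shadow has as put function the hull of `hull (put σ - put α) - put
  -- β`, which is the hull of `put σ - put (α + β)`.
  have hττ : τ' = τ₂ := eq_of_put hδ.remaining h₂.remaining fun k => by
    rw [hδ.put_remaining, h₂.put_remaining]
    have h1 : (fun z => put σ z - put (α + β) z) = fun z => put σ z - put α z - put β z := by
      funext z; rw [put_add hα hβ]; ring
    have h3 := h₂.exists_minorant
    simp_rw [put_add hα hβ, ← sub_sub] at h3
    simp_rw [h.put_remaining]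
    rw [h1, convexHullFun_convexHullFun_sub (convexOn_put hβ) h.exists_minorant h3]
  subst hττ
  refine ⟨δ, hδ, eq_of_put (h.order.2.1.add hδ.order.2.1) h₂.order.2.1 fun k => ?_⟩
  rw [put_add h.order.2.1 hδ.order.2.1]
  linarith [h.put_add_put k, h₂.put_add_put k, hδ.put_add_put k]

/-- At a point of the support of `σ`, the put function of the shadow of a small measure `α` is
close to that of `α`. -/
theorem IsShadowSplit.put_le_add (h : IsShadowSplit σ α η τ) {k ε : ℝ} (hε : 0 < ε)
    (hsmall : α.real univ ≤ σ.real (Ioo (k - ε) (k + ε))) :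
    put η k ≤ put α k + 2 * ε * α.real univ := by
  have hσ := h.finiteFirstMoment
  have hα := h.order.1
  have := hσ.1
  -- A support line of `put σ` at `k - ε`, improved by the mass of the interval around `k`, which
  -- adds to the slope beyond `k + ε`.
  have hlow : ∀ x, put σ (k - ε) + σ.real (Iic (k - ε)) * (x - (k - ε)) +
      σ.real (Ioo (k - ε) (k + ε)) * max (x - (k + ε)) 0 ≤ put σ x := by
    intro x
    have i1 : Integrable (fun y => (Iic (k - ε)).indicator (fun _ => x - (k - ε)) y) σ :=
      (integrable_const _).indicator measurableSet_Iic
    have i2 : Integrable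
        (fun y => (Ioo (k - ε) (k + ε)).indicator (fun _ => max (x - (k + ε)) 0) y) σ :=
      (integrable_const _).indicator measurableSet_Ioo
    have e1 : σ.real (Iic (k - ε)) * (x - (k - ε)) =
        ∫ y, (Iic (k - ε)).indicator (fun _ => x - (k - ε)) y ∂σ := by
      rw [integral_indicator_const _ measurableSet_Iic, smul_eq_mul]
    have e2 : σ.real (Ioo (k - ε) (k + ε)) * max (x - (k + ε)) 0 =
        ∫ y, (Ioo (k - ε) (k + ε)).indicator (fun _ => max (x - (k + ε)) 0) y ∂σ := by
      rw [integral_indicator_const _ measurableSet_Ioo, smul_eq_mul]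
    rw [e1, e2, put, put, ← integral_add (hσ.integrable_put _) i1,
      ← integral_add (f := fun y => max (k - ε - y) 0 + (Iic (k - ε)).indicator
        (fun _ => x - (k - ε)) y) ((hσ.integrable_put _).add i1) i2]
    refine integral_mono (((hσ.integrable_put _).add i1).add i2) (hσ.integrable_put _) fun y => ?_
    simp only [indicator, mem_Iic, mem_Ioo]
    by_cases hy : y ≤ k - ε
    · rw [if_pos hy, if_neg (fun h => by linarith [h.1]), max_eq_left (by linarith)]
      linarith [le_max_left (x - y) 0]
    · rw [if_neg hy, max_eq_right (by linarith)]
      split_ifs with h2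
      · linarith [max_le_max (show x - (k + ε) ≤ x - y by linarith [h2.2]) (le_refl (0 : ℝ))]
      · linarith [le_max_right (x - y) 0]
  -- This line is a minorant of `put σ - put α`: up to `k + ε` by monotonicity of `put α`, and
  -- beyond because the slope of `put α` is at most the mass of `α`, which `hsmall` bounds by the
  -- extra slope. At `k - ε` it yields `put η (k - ε) ≤ put α (k + ε)`, and moving both arguments to
  -- `k` costs `ε` times the mass each.
  have hmin := le_convexHullFun (h := fun z => put σ z - put α z)
    (convexOn_affine (σ.real (Iic (k - ε)))
      (put σ (k - ε) - σ.real (Iic (k - ε)) * (k - ε) - put α (k + ε))) (fun x => by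
      have h1 := hlow x
      rcases le_total x (k + ε) with hx | hx
      · rw [max_eq_right (by linarith)] at h1
        linarith [put_mono hα hx]
      · rw [max_eq_left (by linarith)] at h1
        have h2 := put_le_put_add hα hx
        have h3 := mul_le_mul_of_nonneg_right hsmall (show 0 ≤ x - (k + ε) by linarith)
        linarith) (k - ε)
  rw [← h.put_remaining] at hmin
  have h1 := h.put_add_put (k - ε)
  have h2 := put_le_put_add hα (show k ≤ k + ε by linarith)
  have h3 := put_le_put_add h.order.2.1 (show k - ε ≤ k by linarith)
  rw [← h.mass_eq] at h3
  linarith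

end Shadow

/-! ### The Kellerer dilation and the hitting projection -/

section Dilation

variable {T : Set ℝ} {x : ℝ}

/-- The points of `[inf T, sup T]`, for a closed set `T`. -/
def Between (T : Set ℝ) (x : ℝ) : Prop := (T ∩ Iic x).Nonempty ∧ (T ∩ Ici x).Nonempty

theorem lowerPoint_mem (hT : IsClosed T) (h : Between T x) : lowerPoint T x ∈ T ∩ Iic x :=
  (hT.inter isClosed_Iic).csSup_mem h.1 ⟨x, fun _ hy => hy.2⟩

theorem upperPoint_mem (hT : IsClosed T) (h : Between T x) : upperPoint T x ∈ T ∩ Ici x :=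
  (hT.inter isClosed_Ici).csInf_mem h.2 ⟨x, fun _ hy => hy.2⟩

theorem lowerPoint_lt (hT : IsClosed T) (h : Between T x) (hx : x ∉ T) : lowerPoint T x < x :=
  lt_of_le_of_ne (lowerPoint_mem hT h).2 fun e => hx (e ▸ (lowerPoint_mem hT h).1)

theorem lt_upperPoint (hT : IsClosed T) (h : Between T x) (hx : x ∉ T) : x < upperPoint T x :=
  lt_of_le_of_ne (upperPoint_mem hT h).2 fun e => hx (e ▸ (upperPoint_mem hT h).1)

theorem le_lowerPoint_or_upperPoint_le {y : ℝ} (hy : y ∈ T) :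
    y ≤ lowerPoint T x ∨ upperPoint T x ≤ y := by
  rcases le_total y x with h | h
  · exact Or.inl (le_csSup ⟨x, fun _ hz => hz.2⟩ ⟨hy, h⟩)
  · exact Or.inr (csInf_le ⟨x, fun _ hz => hz.2⟩ ⟨hy, h⟩)

theorem dilation_of_mem (hx : x ∈ T) : dilation T x = Measure.dirac x := if_pos hx

theorem dilation_of_notMem (hx : x ∉ T) : dilation T x =
    ENNReal.ofReal ((upperPoint T x - x) / (upperPoint T x - lowerPoint T x)) •
        Measure.dirac (lowerPoint T x) +
      ENNReal.ofReal ((x - lowerPoint T x) / (upperPoint T x - lowerPoint T x)) •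
        Measure.dirac (upperPoint T x) := if_neg hx

theorem isProbabilityMeasure_dilation (hT : IsClosed T) (h : Between T x) :
    IsProbabilityMeasure (dilation T x) := by
  by_cases hx : x ∈ T
  · rw [dilation_of_mem hx]; infer_instance
  · have h1 := lowerPoint_lt hT h hx
    have h2 := lt_upperPoint hT h hx
    have h3 : 0 < upperPoint T x - lowerPoint T x := by linarith
    constructor
    rw [dilation_of_notMem hx]
    simp only [Measure.coe_add, Measure.coe_smul, Pi.add_apply, Pi.smul_apply, measure_univ,
      smul_eq_mul, mul_one]
    rw [← ENNReal.ofReal_add (div_nonneg (by linarith) h3.le) (div_nonneg (by linarith) h3.le),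
      ← add_div, show upperPoint T x - x + (x - lowerPoint T x) = upperPoint T x - lowerPoint T x
        by ring, div_self h3.ne', ENNReal.ofReal_one]

theorem dilation_compl (hT : IsClosed T) (h : Between T x) : dilation T x Tᶜ = 0 := by
  by_cases hx : x ∈ T
  · rw [dilation_of_mem hx]
    simp [hx]
  · rw [dilation_of_notMem hx]
    simp [(lowerPoint_mem hT h).1, (upperPoint_mem hT h).1]

theorem integrable_dilation (f : ℝ → ℝ) : Integrable f (dilation T x) := by
  by_cases hx : x ∈ T
  · rw [dilation_of_mem hx]
    exact integrable_dirac (by simp)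
  · rw [dilation_of_notMem hx]
    exact ((integrable_dirac (by simp)).smul_measure ENNReal.ofReal_ne_top).add_measure
      ((integrable_dirac (by simp)).smul_measure ENNReal.ofReal_ne_top)

theorem integral_dilation (hT : IsClosed T) (h : Between T x) (hx : x ∉ T) (f : ℝ → ℝ) :
    ∫ y, f y ∂dilation T x =
      (upperPoint T x - x) / (upperPoint T x - lowerPoint T x) * f (lowerPoint T x) +
      (x - lowerPoint T x) / (upperPoint T x - lowerPoint T x) * f (upperPoint T x) := by
  have h1 := lowerPoint_lt hT h hx
  have h2 := lt_upperPoint hT h hx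
  have h3 : 0 < upperPoint T x - lowerPoint T x := by linarith
  rw [dilation_of_notMem hx, integral_add_measure
    ((integrable_dirac (by simp)).smul_measure ENNReal.ofReal_ne_top)
    ((integrable_dirac (by simp)).smul_measure ENNReal.ofReal_ne_top), integral_smul_measure,
    integral_smul_measure, integral_dirac, integral_dirac,
    ENNReal.toReal_ofReal (div_nonneg (by linarith) h3.le),
    ENNReal.toReal_ofReal (div_nonneg (by linarith) h3.le)]
  rfl

/-- `P_T` preserves functions that are affine on the gaps of `T`. -/
theorem integral_dilation_of_affine (hT : IsClosed T) (h : Between T x) {f : ℝ → ℝ}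
    (hf : x ∉ T → ∃ s t : ℝ, f (lowerPoint T x) = s * lowerPoint T x + t ∧
      f x = s * x + t ∧ f (upperPoint T x) = s * upperPoint T x + t) :
    ∫ y, f y ∂dilation T x = f x := by
  by_cases hx : x ∈ T
  · rw [dilation_of_mem hx, integral_dirac]
  · obtain ⟨s, t, e1, e2, e3⟩ := hf hx
    have h1 := lowerPoint_lt hT h hx
    have h2 := lt_upperPoint hT h hx
    have h3 : upperPoint T x - lowerPoint T x ≠ 0 := by linarith
    rw [integral_dilation hT h hx, e1, e2, e3]
    field_simp
    ring

/-- The kink `k` lies in `T`, so the payoff is affine on every gap. -/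
theorem integral_put_dilation (hT : IsClosed T) (h : Between T x) {k : ℝ} (hk : k ∈ T) :
    ∫ y, max (k - y) 0 ∂dilation T x = max (k - x) 0 := by
  refine integral_dilation_of_affine (f := fun y => max (k - y) 0) hT h fun hx => ?_
  have h1 := lowerPoint_lt hT h hx
  have h2 := lt_upperPoint hT h hx
  rcases le_lowerPoint_or_upperPoint_le (x := x) hk with h3 | h3
  · refine ⟨0, 0, ?_, ?_, ?_⟩ <;> rw [max_eq_right (by linarith)] <;> ring
  · refine ⟨-1, k, ?_, ?_, ?_⟩ <;> rw [max_eq_left (by linarith)] <;> ring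

theorem integral_call_dilation (hT : IsClosed T) (h : Between T x) {k : ℝ} (hk : k ∈ T) :
    ∫ y, max (y - k) 0 ∂dilation T x = max (x - k) 0 := by
  refine integral_dilation_of_affine (f := fun y => max (y - k) 0) hT h fun hx => ?_
  have h1 := lowerPoint_lt hT h hx
  have h2 := lt_upperPoint hT h hx
  rcases le_lowerPoint_or_upperPoint_le (x := x) hk with h3 | h3
  · refine ⟨1, -k, ?_, ?_, ?_⟩ <;> rw [max_eq_left (by linarith)] <;> ring
  · refine ⟨0, 0, ?_, ?_, ?_⟩ <;> rw [max_eq_right (by linarith)] <;> ring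

theorem integral_id_dilation (hT : IsClosed T) (h : Between T x) :
    ∫ y, y ∂dilation T x = x :=
  integral_dilation_of_affine (f := fun y => y) hT h fun _ => ⟨1, 0, by simp⟩

variable {m : Measure ℝ}

theorem lintegral_hittingProjection (hT : IsClosed T) {f : ℝ → ENNReal} (hf : Measurable f) :
    ∫⁻ y, f y ∂hittingProjection m T = ∫⁻ x, ∫⁻ y, f y ∂dilation T x ∂m :=
  Measure.lintegral_bind (measurable_dilation hT.measurableSet).aemeasurable hf.aemeasurable

theorem hittingProjection_univ (hT : IsClosed T) (hm : ∀ᵐ x ∂m, Between T x) :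
    hittingProjection m T univ = m univ := by
  rw [hittingProjection_apply m hT.measurableSet MeasurableSet.univ, ← lintegral_one]
  refine lintegral_congr_ae (hm.mono fun x hx => ?_)
  have := isProbabilityMeasure_dilation hT hx
  exact measure_univ

theorem hittingProjection_compl (hT : IsClosed T) (hm : ∀ᵐ x ∂m, Between T x) :
    hittingProjection m T Tᶜ = 0 := by
  rw [hittingProjection_apply m hT.measurableSet hT.measurableSet.compl,
    lintegral_congr_ae (hm.mono fun x hx => dilation_compl hT hx), lintegral_zero]

theorem lintegral_hittingProjection_eq (hT : IsClosed T) (hm : ∀ᵐ x ∂m, Between T x) {f : ℝ → ℝ}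
    (hf : Measurable f) (hf0 : ∀ x, 0 ≤ f x)
    (h : ∀ x, Between T x → ∫ y, f y ∂dilation T x = f x) :
    ∫⁻ y, ENNReal.ofReal (f y) ∂hittingProjection m T = ∫⁻ x, ENNReal.ofReal (f x) ∂m := by
  rw [lintegral_hittingProjection hT (by fun_prop)]
  refine lintegral_congr_ae (hm.mono fun x hx => ?_)
  simp only
  rw [← ofReal_integral_eq_lintegral_ofReal (integrable_dilation f) (ae_of_all _ hf0), h x hx]

theorem integral_hittingProjection_eq (hT : IsClosed T) (hm : ∀ᵐ x ∂m, Between T x) {f : ℝ → ℝ}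
    (hf : Measurable f) (hf0 : ∀ x, 0 ≤ f x)
    (h : ∀ x, Between T x → ∫ y, f y ∂dilation T x = f x) :
    ∫ y, f y ∂hittingProjection m T = ∫ x, f x ∂m := by
  rw [integral_eq_lintegral_of_nonneg_ae (ae_of_all _ hf0) hf.aestronglyMeasurable,
    integral_eq_lintegral_of_nonneg_ae (ae_of_all _ hf0) hf.aestronglyMeasurable,
    lintegral_hittingProjection_eq hT hm hf hf0 h]

/-- For a strike `k ∈ T` both put and call are preserved, and `y = (y - k)⁺ - (k - y)⁺ + k`. -/
theorem finiteFirstMoment_hittingProjection (hT : IsClosed T) (hne : T.Nonempty)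
    (hm : ∀ᵐ x ∂m, Between T x) (hmf : FiniteFirstMoment m) :
    FiniteFirstMoment (hittingProjection m T) := by
  obtain ⟨k, hk⟩ := hne
  have := hmf.1
  have hfin : IsFiniteMeasure (hittingProjection m T) :=
    ⟨by rw [hittingProjection_univ hT hm]; exact measure_lt_top _ _⟩
  have key : ∀ f : ℝ → ℝ, Measurable f → (∀ x, 0 ≤ f x) →
      (∀ x, Between T x → ∫ y, f y ∂dilation T x = f x) → Integrable f m →
      Integrable f (hittingProjection m T) := fun f hf hf0 h hi => by
    refine ⟨hf.aestronglyMeasurable, ?_⟩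
    rw [hasFiniteIntegral_iff_ofReal (ae_of_all _ hf0),
      lintegral_hittingProjection_eq hT hm hf hf0 h,
      ← ofReal_integral_eq_lintegral_ofReal hi (ae_of_all _ hf0)]
    exact ENNReal.ofReal_lt_top
  have h1 := key (fun y => max (k - y) 0) (by fun_prop) (fun _ => le_max_right _ _)
    (fun x hx => integral_put_dilation hT hx hk) (hmf.integrable_put k)
  have h2 := key (fun y => max (y - k) 0) (by fun_prop) (fun _ => le_max_right _ _)
    (fun x hx => integral_call_dilation hT hx hk) (hmf.integrable_call k)
  refine ⟨hfin, ((h2.sub h1).add (integrable_const k)).congr (ae_of_all _ fun y => ?_)⟩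
  simp only [Pi.add_apply, Pi.sub_apply]
  rcases le_total k y with h | h
  · rw [max_eq_left (by linarith), max_eq_right (by linarith)]; ring
  · rw [max_eq_right (by linarith), max_eq_left (by linarith)]; ring

theorem put_hittingProjection_of_mem (hT : IsClosed T) (hm : ∀ᵐ x ∂m, Between T x) {k : ℝ}
    (hk : k ∈ T) : put (hittingProjection m T) k = put m k :=
  integral_hittingProjection_eq hT hm (f := fun y => max (k - y) 0) (by fun_prop)
    (fun _ => le_max_right _ _) fun _ hx => integral_put_dilation hT hx hk

theorem mass_hittingProjection (hT : IsClosed T) (hm : ∀ᵐ x ∂m, Between T x) :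
    (hittingProjection m T).real univ = m.real univ := by
  rw [Measure.real, hittingProjection_univ hT hm, Measure.real]

theorem mean_hittingProjection (hT : IsClosed T) (hne : T.Nonempty)
    (hm : ∀ᵐ x ∂m, Between T x) (hmf : FiniteFirstMoment m) :
    ∫ y, y ∂hittingProjection m T = ∫ x, x ∂m := by
  have hf := finiteFirstMoment_hittingProjection hT hne hm hmf
  obtain ⟨k, hk⟩ := hne
  have h1 := put_eq_add_call hf k
  have h2 := put_eq_add_call hmf k
  rw [put_hittingProjection_of_mem hT hm hk, mass_hittingProjection hT hm,
    integral_hittingProjection_eq hT hm (f := fun y => max (y - k) 0) (by fun_prop)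
    (fun _ => le_max_right _ _) fun _ hx => integral_call_dilation hT hx hk] at h1
  linarith

variable {ρ : Measure ℝ} {k : ℝ}

theorem put_eq_zero_of_lt (hρ : ρ Tᶜ = 0) (hk : ∀ t ∈ T, k ≤ t) : put ρ k = 0 :=
  integral_eq_zero_of_ae ((measure_eq_zero_iff_ae_notMem.1 hρ).mono fun y hy =>
    max_eq_right (by linarith [hk y (not_not.1 hy)]))

theorem put_eq_of_gt (hf : FiniteFirstMoment ρ) (hρ : ρ Tᶜ = 0) (hk : ∀ t ∈ T, t ≤ k) :
    put ρ k = ρ.real univ * k - ∫ y, y ∂ρ := by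
  rw [put_eq_add_call hf, integral_eq_zero_of_ae (f := fun y => max (y - k) 0)
    ((measure_eq_zero_iff_ae_notMem.1 hρ).mono
    fun y hy => max_eq_right (by linarith [hk y (not_not.1 hy)])), add_zero]

/-- No `y ∈ T` lies inside the gap around `k`, so `(k - y)⁺` is affine in the strike on that gap. -/
theorem put_eq_interpolation (hf : FiniteFirstMoment ρ) (hT : IsClosed T) (hρ : ρ Tᶜ = 0)
    (h : Between T k) (hk : k ∉ T) : put ρ k =
      (upperPoint T k - k) / (upperPoint T k - lowerPoint T k) * put ρ (lowerPoint T k) +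
      (k - lowerPoint T k) / (upperPoint T k - lowerPoint T k) * put ρ (upperPoint T k) := by
  have h1 := lowerPoint_lt hT h hk
  have h2 := lt_upperPoint hT h hk
  have h3 : upperPoint T k - lowerPoint T k ≠ 0 := by linarith
  simp only [put]
  rw [← integral_const_mul, ← integral_const_mul, ← integral_add
    ((hf.integrable_put _).const_mul _) ((hf.integrable_put _).const_mul _)]
  refine integral_congr_ae ((measure_eq_zero_iff_ae_notMem.1 hρ).mono fun y hy => ?_)
  simp only
  rcases le_lowerPoint_or_upperPoint_le (x := k) (not_not.1 hy) with h4 | h4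
  · rw [max_eq_left (by linarith), max_eq_left (by linarith), max_eq_left (by linarith)]
    field_simp
    ring
  · rw [max_eq_right (by linarith), max_eq_right (by linarith), max_eq_right (by linarith)]
    ring

end Dilation

/-! ### Infinitesimal shadows are hitting projections -/

section Derivative

variable {ι : Type*} {l : Filter ι} {σ m : Measure ℝ} {α η τ : ι → Measure ℝ} {h : ι → ℝ}

/-- Convex order gives the lower bound. For the upper bound, every neighbourhood of `k` has a fixed
positive `σ`-mass, which eventually exceeds the mass of `α i`, so `put_le_add` applies with any `ε`.
-/
theorem tendsto_put_shadow_of_mem_support (hh : Tendsto h l (𝓝 0)) (hpos : ∀ᶠ i in l, 0 < h i)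
    (hs : ∀ᶠ i in l, IsShadowSplit σ (α i) (η i) (τ i)) (hα : ∀ᶠ i in l, (α i).real univ = h i)
    {k p : ℝ} (hk : k ∈ σ.support) (hp : Tendsto (fun i => put (α i) k / h i) l (𝓝 p)) :
    Tendsto (fun i => put (η i) k / h i) l (𝓝 p) := by
  rcases l.eq_or_neBot with rfl | hne
  · exact tendsto_bot
  have hσ : FiniteFirstMoment σ := hs.exists.choose_spec.finiteFirstMoment
  have := hσ.1
  refine tendsto_order.2 ⟨fun a ha => ?_, fun a ha => ?_⟩
  · filter_upwards [hp.eventually_const_lt ha, hs, hpos] with i h1 h2 h3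
    exact h1.trans_le (div_le_div_of_nonneg_right (h2.put_le k) h3.le)
  -- One `ε` is lost in the convergence of `put (α i) k / h i` and two in `put_le_add`, leaving a
  -- margin of one.
  · set ε := (a - p) / 4 with hε
    have hε0 : 0 < ε := by linarith
    have hc : 0 < σ.real (Ioo (k - ε) (k + ε)) :=
      ENNReal.toReal_pos ((Measure.mem_support_iff_forall k).1 hk _
        (Ioo_mem_nhds (by linarith) (by linarith))).ne' (measure_ne_top _ _)
    filter_upwards [hp.eventually_lt_const (show p < p + ε by linarith), hs, hpos, hα,
      hh.eventually_lt_const hc] with i h1 h2 h3 h4 h5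
    have h6 := h2.put_le_add hε0 (h4 ▸ h5.le)
    rw [div_lt_iff₀ h3] at h1 ⊢
    rw [h4] at h6
    nlinarith

/-- The limit of the normalized measures `α i` is carried by `[inf T, sup T]`, with `T` the support
of `σ`, if their shadows in `σ` exist. -/
theorem ae_between_of_tendsto [l.NeBot] (hh : Tendsto h l (𝓝 0)) (hpos : ∀ᶠ i in l, 0 < h i)
    (hs : ∀ᶠ i in l, IsShadowSplit σ (α i) (η i) (τ i)) (hα : ∀ᶠ i in l, (α i).real univ = h i)
    (hσ0 : σ ≠ 0) (hm : FiniteFirstMoment m) (hm1 : m.real univ = 1)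
    (hput : ∀ k, Tendsto (fun i => put (α i) k / h i) l (𝓝 (put m k)))
    (hmean : Tendsto (fun i => (∫ y, y ∂α i) / h i) l (𝓝 (∫ y, y ∂m))) :
    ∀ᵐ x ∂m, Between σ.support x := by
  have hT : IsClosed σ.support := Measure.isClosed_support
  have hne : σ.support.Nonempty := Measure.nonempty_support hσ0
  have hη0 : ∀ᶠ i in l, η i σ.supportᶜ = 0 := hs.mono fun i hi =>
    le_antisymm ((hi.le _).trans_eq Measure.measure_compl_support) bot_le
  refine Filter.Eventually.and ?_ ?_
  -- If the support has a least element `a`, the shadows have put `0` at `a`, hence so has `m`, and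
  -- `m` does not charge `(-∞, a)`. Otherwise the closed support is unbounded below.
  · by_cases hb : ∃ a ∈ σ.support, ∀ t ∈ σ.support, a ≤ t
    · obtain ⟨a, ha, hat⟩ := hb
      have h1 := tendsto_put_shadow_of_mem_support hh hpos hs hα ha (hput a)
      have h2 : put m a = 0 := tendsto_nhds_unique h1 (tendsto_const_nhds.congr'
        (hη0.mono fun i hi => by simp only [put_eq_zero_of_lt hi hat, zero_div]))
      have h3 := (integral_eq_zero_iff_of_nonneg (fun _ => le_max_right _ _)
        (hm.integrable_put a)).1 h2
      filter_upwards [h3] with x hx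
      have hx : max (a - x) 0 = 0 := hx
      exact ⟨a, ha, by simpa using hx⟩
    · refine ae_of_all _ fun x => ?_
      by_contra hx
      have hlt : ∀ t ∈ σ.support, x < t := fun t ht => by
        by_contra h'
        exact hx ⟨t, ht, not_lt.1 h'⟩
      have hbd : BddBelow σ.support := ⟨x, fun t ht => (hlt t ht).le⟩
      exact hb ⟨sInf σ.support, hT.csInf_mem hne hbd, fun t ht => csInf_le hbd ht⟩
  -- The mirror image: at a greatest element the put equals its affine asymptote, so the call of `m`
  -- vanishes there.
  · by_cases hb : ∃ a ∈ σ.support, ∀ t ∈ σ.support, t ≤ a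
    · obtain ⟨a, ha, hat⟩ := hb
      have h1 := tendsto_put_shadow_of_mem_support hh hpos hs hα ha (hput a)
      have h2 : put m a = a - ∫ y, y ∂m := by
        refine tendsto_nhds_unique h1 ((tendsto_const_nhds.sub hmean).congr' ?_)
        filter_upwards [hη0, hs, hα, hpos] with i i1 i2 i3 i4
        rw [put_eq_of_gt i2.order.2.1 i1 hat, ← i2.mass_eq, ← i2.mean_eq, i3, sub_div,
          mul_div_cancel_left₀ _ i4.ne']
      rw [put_eq_add_call hm, hm1, one_mul, add_eq_left] at h2
      have h3 := (integral_eq_zero_iff_of_nonneg (fun _ => le_max_right _ _)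
        (hm.integrable_call a)).1 h2
      filter_upwards [h3] with x hx
      have hx : max (x - a) 0 = 0 := hx
      exact ⟨a, ha, by simpa using hx⟩
    · refine ae_of_all _ fun x => ?_
      by_contra hx
      have hlt : ∀ t ∈ σ.support, t < x := fun t ht => by
        by_contra h'
        exact hx ⟨t, ht, not_lt.1 h'⟩
      have hbd : BddAbove σ.support := ⟨x, fun t ht => (hlt t ht).le⟩
      exact hb ⟨sSup σ.support, hT.csSup_mem hne hbd, fun t ht => le_csSup hbd ht⟩

/-- Shadows of small measures are asymptotically given by the hitting projection. -/
theorem tendsto_put_shadow [l.NeBot] (hh : Tendsto h l (𝓝 0)) (hpos : ∀ᶠ i in l, 0 < h i)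
    (hs : ∀ᶠ i in l, IsShadowSplit σ (α i) (η i) (τ i)) (hα : ∀ᶠ i in l, (α i).real univ = h i)
    (hσ0 : σ ≠ 0) (hm : FiniteFirstMoment m) (hm1 : m.real univ = 1)
    (hput : ∀ k, Tendsto (fun i => put (α i) k / h i) l (𝓝 (put m k)))
    (hmean : Tendsto (fun i => (∫ y, y ∂α i) / h i) l (𝓝 (∫ y, y ∂m))) (k : ℝ) :
    Tendsto (fun i => put (η i) k / h i) l (𝓝 (put (hittingProjection m σ.support) k)) := by
  have hT : IsClosed σ.support := Measure.isClosed_support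
  have hne : σ.support.Nonempty := Measure.nonempty_support hσ0
  have hb := ae_between_of_tendsto hh hpos hs hα hσ0 hm hm1 hput hmean
  have hη0 : ∀ᶠ i in l, η i σ.supportᶜ = 0 := hs.mono fun i hi =>
    le_antisymm ((hi.le _).trans_eq Measure.measure_compl_support) bot_le
  have hPf := finiteFirstMoment_hittingProjection hT hne hb hm
  have hP0 := hittingProjection_compl hT hb
  have hmem : ∀ k ∈ σ.support, Tendsto (fun i => put (η i) k / h i) l
      (𝓝 (put (hittingProjection m σ.support) k)) := fun k hk => by
    rw [put_hittingProjection_of_mem hT hb hk]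
    exact tendsto_put_shadow_of_mem_support hh hpos hs hα hk (hput k)
  by_cases hk : k ∈ σ.support
  · exact hmem k hk
  -- Off the support, the shadows and the hitting projection obey the same formulas, being carried
  -- by the support: interpolation inside a gap, the affine asymptote to the right of the support,
  -- and `0` to its left.
  by_cases h1 : (σ.support ∩ Iic k).Nonempty
  · by_cases h2 : (σ.support ∩ Ici k).Nonempty
    · rw [put_eq_interpolation hPf hT hP0 ⟨h1, h2⟩ hk]
      refine (((hmem _ (lowerPoint_mem hT ⟨h1, h2⟩).1).const_mul _).add
        ((hmem _ (upperPoint_mem hT ⟨h1, h2⟩).1).const_mul _)).congr' ?_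
      filter_upwards [hη0, hs] with i i1 i2
      rw [put_eq_interpolation i2.order.2.1 hT i1 ⟨h1, h2⟩ hk, add_div, mul_div_assoc,
        mul_div_assoc]
    · have hat : ∀ t ∈ σ.support, t ≤ k := fun t ht => by
        by_contra h'
        exact h2 ⟨t, ht, (not_le.1 h').le⟩
      rw [put_eq_of_gt hPf hP0 hat, mass_hittingProjection hT hb, hm1,
        mean_hittingProjection hT hne hb hm, one_mul]
      refine (tendsto_const_nhds.sub hmean).congr' ?_
      filter_upwards [hη0, hs, hα, hpos] with i i1 i2 i3 i4
      rw [put_eq_of_gt i2.order.2.1 i1 hat, ← i2.mass_eq, ← i2.mean_eq, i3, sub_div,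
        mul_div_cancel_left₀ _ i4.ne']
  · have hat : ∀ t ∈ σ.support, k ≤ t := fun t ht => by
      by_contra h'
      exact h1 ⟨t, ht, (not_le.1 h').le⟩
    rw [put_eq_zero_of_lt hP0 hat]
    exact tendsto_const_nhds.congr' (hη0.mono fun i hi => by
      simp only [put_eq_zero_of_lt hi hat, zero_div])

theorem supportWithin_of_ae_between {T : Set ℝ} (hT : IsClosed T) (hne : T.Nonempty)
    (h : ∀ᵐ x ∂m, Between T x) : SupportWithin m T := by
  intro x hx
  constructor
  · by_cases h1 : (T ∩ Iic x).Nonempty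
    · obtain ⟨t, ht, htx⟩ := h1
      exact (sInf_le (mem_image_of_mem _ ht)).trans (EReal.coe_le_coe_iff.2 htx)
    · exfalso
      have hlt : ∀ t ∈ T, x < t := fun t ht => by
        by_contra h'
        exact h1 ⟨t, ht, not_lt.1 h'⟩
      have hbd : BddBelow T := ⟨x, fun t ht => (hlt t ht).le⟩
      have hx' := (Measure.mem_support_iff_forall x).1 hx (Iio (sInf T))
        (Iio_mem_nhds (hlt _ (hT.csInf_mem hne hbd)))
      refine hx'.ne' (measure_mono_null (fun y hy => ?_) h)
      rintro ⟨⟨t, ht, hty⟩, -⟩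
      exact absurd (csInf_le hbd ht) (not_le.2 (lt_of_le_of_lt hty hy))
  · by_cases h1 : (T ∩ Ici x).Nonempty
    · obtain ⟨t, ht, htx⟩ := h1
      exact (EReal.coe_le_coe_iff.2 htx).trans (le_sSup (mem_image_of_mem _ ht))
    · exfalso
      have hlt : ∀ t ∈ T, t < x := fun t ht => by
        by_contra h'
        exact h1 ⟨t, ht, not_lt.1 h'⟩
      have hbd : BddAbove T := ⟨x, fun t ht => (hlt t ht).le⟩
      have hx' := (Measure.mem_support_iff_forall x).1 hx (Ioi (sSup T))
        (Ioi_mem_nhds (hlt _ (hT.csSup_mem hne hbd)))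
      refine hx'.ne' (measure_mono_null (fun y hy => ?_) h)
      rintro ⟨-, ⟨t, ht, hty⟩⟩
      exact absurd (le_csSup hbd ht) (not_le.2 (lt_of_lt_of_le hy hty))

end Derivative

/-! ### Primitive curves and disintegrations -/

section Primitive

instance : IsProbabilityMeasure unitLebesgue := ⟨by simp [unitLebesgue]⟩

variable {E : Type*} [MeasurableSpace E] {θ : Measure (ℝ × E)}

theorem primitive_mono : Monotone (primitive θ) := fun _ _ h =>
  Measure.map_mono (Measure.restrict_mono (prod_mono (Icc_subset_Icc_right h) le_rfl) le_rfl)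
    measurable_snd

theorem primitive_le_snd (u : ℝ) : primitive θ u ≤ θ.snd :=
  Measure.map_mono Measure.restrict_le_self measurable_snd

theorem primitive_apply (u : ℝ) {A : Set E} (hA : MeasurableSet A) :
    primitive θ u A = θ (Icc 0 u ×ˢ A) := by
  rw [primitive, Measure.snd_apply hA, Measure.restrict_apply (measurable_snd hA)]
  congr 1
  ext p
  simp only [mem_inter_iff, mem_preimage, mem_prod, mem_univ, and_true]
  exact and_comm

variable {κ : Kernel ℝ ℝ} {θ : Measure (ℝ × ℝ)}

theorem integral_primitive (h : IsDisintegration θ κ) {f : ℝ → ℝ} (hf : Integrable f θ.snd)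
    {u : ℝ} (hu : u ∈ Icc (0 : ℝ) 1) :
    ∫ y, f y ∂primitive θ u = ∫ s in (0 : ℝ)..u, ∫ y, f y ∂κ s := by
  have := h.1
  have hf' : Integrable (fun p : ℝ × ℝ => f p.2) θ := hf.comp_measurable measurable_snd
  have hfm : AEStronglyMeasurable f (primitive θ u) := hf.1.mono_measure (primitive_le_snd u)
  rw [primitive, Measure.snd, integral_map measurable_snd.aemeasurable hfm, ← h.2,
    Measure.setIntegral_compProd measurableSet_Icc MeasurableSet.univ (by
      rw [h.2]; exact hf'.integrableOn), unitLebesgue,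
    Measure.restrict_restrict measurableSet_Icc, intervalIntegral.integral_of_le hu.1,
    ← integral_Icc_eq_integral_Ioc, inter_eq_left.2 (Icc_subset_Icc_right hu.2)]
  simp

theorem ae_integrable_disintegration (h : IsDisintegration θ κ) {f : ℝ → ℝ}
    (hf : Integrable f θ.snd) : ∀ᵐ u ∂unitLebesgue, Integrable f (κ u) := by
  have := h.1
  have hf' : Integrable (fun p : ℝ × ℝ => f p.2) θ := hf.comp_measurable measurable_snd
  rw [← h.2] at hf'
  exact ((Measure.integrable_compProd_iff hf'.1).1 hf').1

theorem integrable_integral_disintegration (h : IsDisintegration θ κ) {f : ℝ → ℝ}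
    (hf : Integrable f θ.snd) : Integrable (fun u => ∫ y, f y ∂κ u) unitLebesgue := by
  have := h.1
  have hf' : Integrable (fun p : ℝ × ℝ => f p.2) θ := hf.comp_measurable measurable_snd
  rw [← h.2] at hf'
  exact hf'.integral_compProd

/-- Lebesgue differentiation. The exceptional null set depends on `f`, which is why a reduction to
countably many test functions is needed. -/
theorem ae_hasDerivWithinAt_primitive (h : IsDisintegration θ κ) {f : ℝ → ℝ}
    (hf : Integrable f θ.snd) : ∀ᵐ u ∂unitLebesgue,
      HasDerivWithinAt (fun t => ∫ y, f y ∂primitive θ t) (∫ y, f y ∂κ u) (Icc 0 1) u := by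
  have hi := integrable_integral_disintegration h hf
  have hi' : IntervalIntegrable (fun u => ∫ y, f y ∂κ u) volume 0 1 := by
    rw [intervalIntegrable_iff_integrableOn_Icc_of_le zero_le_one]
    exact hi
  rw [unitLebesgue, ae_restrict_iff' measurableSet_Icc]
  filter_upwards [hi'.ae_hasDerivAt_integral] with u hu hu1
  rw [uIcc_of_le zero_le_one] at hu
  exact (hu hu1 0 ⟨le_rfl, zero_le_one⟩).hasDerivWithinAt.congr
    (fun t ht => integral_primitive h hf ht) (integral_primitive h hf hu1)

end Primitive

/-! ### Differentiating curves of measures with countably many test functions -/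

section Approximation

variable {c : ℝ → Measure ℝ} {m : Measure ℝ} {u : ℝ}

/-- Both `v - g` and `v + g` are nonnegative, so their integrals increase from `α` to `β`. -/
theorem abs_integral_sub_le {α β : Measure ℝ} (hαβ : α ≤ β) {g v : ℝ → ℝ} (hg : Integrable g β)
    (hv : Integrable v β) (hgv : ∀ x, |g x| ≤ v x) :
    |∫ x, g x ∂β - ∫ x, g x ∂α| ≤ ∫ x, v x ∂β - ∫ x, v x ∂α := by
  have h1 := integral_mono_measure hαβ (f := fun x => v x - g x)
    (ae_of_all _ fun x => sub_nonneg.2 ((le_abs_self _).trans (hgv x))) (hv.sub hg)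
  have h2 := integral_mono_measure hαβ (f := fun x => v x + g x)
    (ae_of_all _ fun x => by simp only [Pi.zero_apply]; linarith [neg_abs_le (g x), hgv x])
    (hv.add hg)
  rw [integral_sub (hv.mono_measure hαβ) (hg.mono_measure hαβ), integral_sub hv hg] at h1
  rw [integral_add (hv.mono_measure hαβ) (hg.mono_measure hαβ), integral_add hv hg] at h2
  rw [abs_le]
  constructor <;> linarith

/-- Differentiability of an increasing curve of measures can be tested on functions which
approximate a given function. -/
theorem hasDerivWithinAt_of_approx {S : Set ℝ} (hc : Monotone c) {f : ℝ → ℝ}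
    (hfc : ∀ t, Integrable f (c t)) (hfm : Integrable f m)
    (h : ∀ ε > 0, ∃ g v : ℝ → ℝ, (∀ t, Integrable g (c t)) ∧ (∀ t, Integrable v (c t)) ∧
      Integrable g m ∧ Integrable v m ∧ (∀ x, |f x - g x| ≤ v x) ∧ ∫ x, v x ∂m ≤ ε ∧
      HasDerivWithinAt (fun t => ∫ x, g x ∂c t) (∫ x, g x ∂m) S u ∧
      HasDerivWithinAt (fun t => ∫ x, v x ∂c t) (∫ x, v x ∂m) S u) :
    HasDerivWithinAt (fun t => ∫ x, f x ∂c t) (∫ x, f x ∂m) S u := by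
  rw [hasDerivWithinAt_iff_tendsto_slope]
  refine Metric.tendsto_nhds.2 fun ε hε => ?_
  obtain ⟨g, v, hgc, hvc, hgm, hvm, hfg, hvε, hg, hv⟩ := h (ε / 4) (by linarith)
  rw [hasDerivWithinAt_iff_tendsto_slope] at hg hv
  have hmem : ∀ᶠ t in 𝓝[S \ {u}] u, t ∈ S \ {u} := self_mem_nhdsWithin
  filter_upwards [Metric.tendsto_nhds.1 hg (ε / 4) (by linarith),
    Metric.tendsto_nhds.1 hv (ε / 4) (by linarith), hmem] with t h1 h2 ht
  rw [Real.dist_eq] at h1 h2 ⊢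
  have htu : t ≠ u := ht.2
  -- The curve increases, so the bound `|f - g| ≤ v` passes to difference quotients on either side
  -- of `u`.
  have key : |slope (fun t => ∫ x, f x ∂c t) u t - slope (fun t => ∫ x, g x ∂c t) u t| ≤
      slope (fun t => ∫ x, v x ∂c t) u t := by
    simp only [slope_def_field, ← sub_div]
    have e : (∫ x, f x ∂c t - ∫ x, f x ∂c u) - (∫ x, g x ∂c t - ∫ x, g x ∂c u) =
        ∫ x, (f x - g x) ∂c t - ∫ x, (f x - g x) ∂c u := by
      rw [integral_sub (hfc t) (hgc t), integral_sub (hfc u) (hgc u)]; ring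
    rw [e, abs_div]
    rcases lt_or_gt_of_ne htu with hlt | hlt
    · have := abs_integral_sub_le (hc hlt.le) ((hfc u).sub (hgc u)) (hvc u) hfg
      simp only [Pi.sub_apply] at this
      rw [abs_of_neg (sub_neg.2 hlt), abs_sub_comm, ← neg_sub u t, neg_neg,
        ← neg_sub (∫ x, v x ∂c u), neg_div_neg_eq]
      exact div_le_div_of_nonneg_right this (by linarith)
    · have := abs_integral_sub_le (hc hlt.le) ((hfc t).sub (hgc t)) (hvc t) hfg
      simp only [Pi.sub_apply] at this
      rw [abs_of_pos (sub_pos.2 hlt)]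
      exact div_le_div_of_nonneg_right this (by linarith)
  have h3 : |∫ x, f x ∂m - ∫ x, g x ∂m| ≤ ε / 4 := by
    rw [← integral_sub hfm hgm]
    refine (norm_integral_le_integral_norm _).trans ((integral_mono (hfm.sub hgm).norm hvm
      fun x => ?_).trans hvε)
    exact hfg x
  rw [abs_lt] at h1 h2 ⊢
  rw [abs_le] at key h3
  constructor <;> linarith [h1.1, h1.2, h2.1, h2.2, key.1, key.2, h3.1, h3.2]

/-- A continuous cut-off function, equal to `0` on `[-n, n]` and to `1` outside `[-n-1, n+1]`. -/
noncomputable def cutoff (n : ℕ) (x : ℝ) : ℝ := min 1 (max (|x| - n) 0)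

theorem continuous_cutoff (n : ℕ) : Continuous (cutoff n) := by
  unfold cutoff; fun_prop

theorem cutoff_nonneg (n : ℕ) (x : ℝ) : 0 ≤ cutoff n x := le_min zero_le_one (le_max_right _ _)

theorem cutoff_le_one (n : ℕ) (x : ℝ) : cutoff n x ≤ 1 := min_le_left _ _

theorem cutoff_eq_one {n : ℕ} {x : ℝ} (h : (n : ℝ) + 1 ≤ |x|) : cutoff n x = 1 :=
  min_eq_left (le_max_of_le_left (by linarith))

theorem cutoff_eq_zero {n : ℕ} {x : ℝ} (h : |x| ≤ n) : cutoff n x = 0 := by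
  rw [cutoff, max_eq_right (by linarith), min_eq_right zero_le_one]

/-- Density in `C(ℝ, ℝ)` refers to the compact-open topology, that is, to uniform convergence on
compact sets. -/
theorem exists_denseSeq_near {f : ℝ → ℝ} (hf : Continuous f) (R : ℝ) {ε : ℝ} (hε : 0 < ε) :
    ∃ i, ∀ x, |x| ≤ R → |f x - TopologicalSpace.denseSeq C(ℝ, ℝ) i x| < ε := by
  have h1 := (ContinuousMap.tendsto_iff_forall_isCompact_tendstoUniformlyOn.1
    (tendsto_id (x := 𝓝 (⟨f, hf⟩ : C(ℝ, ℝ))))) (Icc (-R) R) isCompact_Icc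
  have h2 := Metric.tendstoUniformlyOn_iff.1 h1 ε hε
  obtain ⟨_, h3, i, rfl⟩ := mem_closure_iff_nhds.1
    ((TopologicalSpace.denseRange_denseSeq C(ℝ, ℝ)) ⟨f, hf⟩) _ h2
  exact ⟨i, fun x hx => by simpa [Real.dist_eq] using h3 x (abs_le.1 hx)⟩

theorem exists_bound_mul_cutoff {g : ℝ → ℝ} (hg : Continuous g) (n : ℕ) :
    ∃ C, ∀ x, |g x * (1 - cutoff n x)| ≤ C * (1 + |x|) := by
  obtain ⟨C, hC⟩ := (isCompact_Icc (a := -((n : ℝ) + 1)) (b := (n : ℝ) + 1)).exists_bound_of_continuousOn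
    hg.continuousOn
  refine ⟨max C 0, fun x => ?_⟩
  rw [abs_mul, abs_of_nonneg (sub_nonneg.2 (cutoff_le_one n x))]
  have h0 : 0 ≤ max C 0 := le_max_right _ _
  rcases le_total ((n : ℝ) + 1) |x| with h | h
  · rw [cutoff_eq_one h, sub_self, mul_zero]
    positivity
  · have h1 : |g x| ≤ max C 0 := (hC x (abs_le.1 h)).trans (le_max_left _ _)
    have h2 := cutoff_nonneg n x
    have h3 := cutoff_le_one n x
    calc |g x| * (1 - cutoff n x) ≤ max C 0 * 1 := by gcongr; linarith
      _ ≤ _ := by gcongr; linarith [abs_nonneg x]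

theorem abs_weight_cutoff_le (n : ℕ) (x : ℝ) : |(1 + |x|) * cutoff n x| ≤ 1 * (1 + |x|) := by
  rw [abs_of_nonneg (mul_nonneg (by positivity) (cutoff_nonneg n x)), one_mul]
  exact mul_le_of_le_one_right (by positivity) (cutoff_le_one n x)

theorem FiniteFirstMoment.tendsto_integral_weight_cutoff (hm : FiniteFirstMoment m) :
    Tendsto (fun n : ℕ => ∫ x, (1 + |x|) * cutoff n x ∂m) atTop (𝓝 0) := by
  have := hm.1
  have h0 : (0 : ℝ) = ∫ _, 0 ∂m := by simp
  rw [h0]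
  refine tendsto_integral_of_dominated_convergence (fun x => 1 * (1 + |x|))
    (fun n => ?_) (((integrable_const _).add hm.2.abs).const_mul 1)
    (fun n => ae_of_all _ fun x => abs_weight_cutoff_le n x) (ae_of_all _ fun x => ?_)
  · have := continuous_cutoff n
    exact (by fun_prop : Continuous fun x : ℝ => (1 + |x|) * cutoff n x).aestronglyMeasurable
  · refine tendsto_const_nhds.congr' ?_
    filter_upwards [eventually_ge_atTop ⌈|x|⌉₊] with n hn
    rw [cutoff_eq_zero ((Nat.le_ceil _).trans (Nat.cast_le.2 hn)), mul_zero]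

/-- Countably many test functions suffice for the differentiability of a curve of measures. -/
theorem hasMeasureDerivAt_of_countable (hc : Monotone c) (hcf : ∀ t, FiniteFirstMoment (c t))
    (hm : FiniteFirstMoment m)
    (h1 : HasDerivWithinAt (fun t => ∫ x, (1 + |x|) ∂c t) (∫ x, (1 + |x|) ∂m) (Icc 0 1) u)
    (h2 : ∀ n : ℕ, HasDerivWithinAt (fun t => ∫ x, (1 + |x|) * cutoff n x ∂c t)
      (∫ x, (1 + |x|) * cutoff n x ∂m) (Icc 0 1) u)
    (h3 : ∀ i n : ℕ, HasDerivWithinAt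
      (fun t => ∫ x, TopologicalSpace.denseSeq C(ℝ, ℝ) i x * (1 - cutoff n x) ∂c t)
      (∫ x, TopologicalSpace.denseSeq C(ℝ, ℝ) i x * (1 - cutoff n x) ∂m) (Icc 0 1) u) :
    HasMeasureDerivAt c m u := by
  refine ⟨hm, fun f hf ⟨C, hC⟩ => ?_⟩
  have hint : ∀ {f : ℝ → ℝ} {C : ℝ}, Continuous f → (∀ x, |f x| ≤ C * (1 + |x|)) →
      (∀ t, Integrable f (c t)) ∧ Integrable f m := fun hf hC =>
    ⟨fun t => (hcf t).integrable_of_le hf.measurable hC, hm.integrable_of_le hf.measurable hC⟩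
  have hC0 : 0 ≤ C := by
    have := (abs_nonneg _).trans (hC 0)
    simpa using this
  refine hasDerivWithinAt_of_approx hc (hint hf hC).1 (hint hf hC).2 fun ε hε => ?_
  set M := ∫ x, (1 + |x|) ∂m with hM
  have hM0 : 0 ≤ M := integral_nonneg fun x => by positivity
  set δ := ε / (2 * (M + 1)) with hδ
  have hδ0 : 0 < δ := by positivity
  have hδM : δ * M ≤ ε / 2 := by
    rw [hδ, div_mul_eq_mul_div, div_le_div_iff₀ (by positivity) (by positivity)]
    nlinarith
  obtain ⟨n, hn⟩ := (((hm.tendsto_integral_weight_cutoff.const_mul C).eventually_lt_const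
    (show C * 0 < ε / 2 by linarith))).exists
  obtain ⟨i, hi⟩ := exists_denseSeq_near hf ((n : ℝ) + 1) hδ0
  set g := TopologicalSpace.denseSeq C(ℝ, ℝ) i with hg
  obtain ⟨D, hD⟩ := exists_bound_mul_cutoff g.continuous n
  have hcc := continuous_cutoff n
  have hw : Continuous fun x : ℝ => 1 + |x| := by fun_prop
  have hwi := hint hw (C := 1) (fun x => by rw [abs_of_nonneg (by positivity), one_mul])
  have hwci := hint (hw.mul hcc) (abs_weight_cutoff_le n)
  have hgi := hint (g.continuous.mul (continuous_const.sub hcc)) hD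
  have ev : ∀ θ : Measure ℝ, Integrable (fun x : ℝ => 1 + |x|) θ →
      Integrable (fun x => (1 + |x|) * cutoff n x) θ →
      ∫ x, (δ * (1 + |x|) + C * ((1 + |x|) * cutoff n x)) ∂θ =
        δ * ∫ x, (1 + |x|) ∂θ + C * ∫ x, (1 + |x|) * cutoff n x ∂θ := fun θ i1 i2 => by
    rw [integral_add (i1.const_mul δ) (i2.const_mul C), integral_const_mul, integral_const_mul]
  -- Where the cut-off is not `1`, `g` is within `δ` of `f`; the tail `f * cutoff n` is bounded by
  -- `C (1 + |x|) cutoff n`. The choices of `δ` and `n` make each part of the error at most `ε / 2`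
  -- under `m`.
  refine ⟨fun x => g x * (1 - cutoff n x),
    fun x => δ * (1 + |x|) + C * ((1 + |x|) * cutoff n x), hgi.1,
    fun t => ((hwi.1 t).const_mul δ).add ((hwci.1 t).const_mul C), hgi.2,
    (hwi.2.const_mul δ).add (hwci.2.const_mul C), fun x => ?_, ?_, h3 i n, ?_⟩
  · have a1 := cutoff_nonneg n x
    have a2 := cutoff_le_one n x
    have e : f x - g x * (1 - cutoff n x) = (f x - g x) * (1 - cutoff n x) + f x * cutoff n x := by
      ring
    rw [e]
    refine (abs_add_le _ _).trans (add_le_add ?_ ?_)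
    · rw [abs_mul, abs_of_nonneg (sub_nonneg.2 a2)]
      rcases le_total ((n : ℝ) + 1) |x| with h | h
      · rw [cutoff_eq_one h, sub_self, mul_zero]
        positivity
      · calc _ ≤ δ * 1 := by
              gcongr
              · exact (hi x h).le
              · linarith
          _ ≤ _ := by gcongr; linarith [abs_nonneg x]
    · rw [abs_mul, abs_of_nonneg a1, ← mul_assoc]
      exact mul_le_mul_of_nonneg_right (hC x) a1
  · rw [ev m hwi.2 hwci.2]
    linarith
  · rw [ev m hwi.2 hwci.2]
    simp_rw [fun t => ev (c t) (hwi.1 t) (hwci.1 t)]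
    exact (h1.const_mul δ).add ((h2 n).const_mul C)

theorem ae_hasMeasureDerivAt {θ : Measure (ℝ × ℝ)} {κ : Kernel ℝ ℝ} (h : IsDisintegration θ κ)
    (hθ : FiniteFirstMoment θ.snd) :
    ∀ᵐ u ∂unitLebesgue, HasMeasureDerivAt (primitive θ) (κ u) u := by
  have := h.1
  have hint : ∀ {f : ℝ → ℝ} {C : ℝ}, Continuous f → (∀ x, |f x| ≤ C * (1 + |x|)) →
      ∀ᵐ u ∂unitLebesgue,
        HasDerivWithinAt (fun t => ∫ y, f y ∂primitive θ t) (∫ y, f y ∂κ u) (Icc 0 1) u :=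
    fun hf hC => ae_hasDerivWithinAt_primitive h (hθ.integrable_of_le hf.measurable hC)
  have hw : Continuous fun x : ℝ => 1 + |x| := by fun_prop
  have h1 := hint hw (C := 1) (fun x => by rw [abs_of_nonneg (by positivity), one_mul])
  have h2 := fun n : ℕ => hint (hw.mul (continuous_cutoff n)) (abs_weight_cutoff_le n)
  have h3 := fun i n : ℕ => hint
    ((TopologicalSpace.denseSeq C(ℝ, ℝ) i).continuous.mul
      (continuous_const.sub (continuous_cutoff n)))
    (exists_bound_mul_cutoff (TopologicalSpace.denseSeq C(ℝ, ℝ) i).continuous n).choose_spec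
  filter_upwards [h1, ae_all_iff.2 h2, ae_all_iff.2 fun i => ae_all_iff.2 (h3 i),
    ae_integrable_disintegration h hθ.2] with u u1 u2 u3 u4
  exact hasMeasureDerivAt_of_countable primitive_mono
    (fun t => hθ.mono (primitive_le_snd t)) ⟨inferInstance, u4⟩ u1 u2 u3

end Approximation

/-! ### Increments of the primitive curve -/

section Slice

variable {θ : Measure (ℝ × ℝ)} {A B : Set ℝ}

/-- The second marginal of the restriction of `θ` to `A × ℝ`. -/
noncomputable def slice (θ : Measure (ℝ × ℝ)) (A : Set ℝ) : Measure ℝ :=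
  (θ.restrict (A ×ˢ univ)).snd

theorem slice_le_snd : slice θ A ≤ θ.snd :=
  Measure.map_mono Measure.restrict_le_self measurable_snd

theorem slice_add (hB : MeasurableSet B) (h : Disjoint A B) :
    slice θ A + slice θ B = slice θ (A ∪ B) := by
  rw [slice, slice, slice, union_prod, Measure.restrict_union
    (disjoint_prod.2 (Or.inl h)) (hB.prod MeasurableSet.univ), Measure.snd, Measure.snd,
    Measure.snd, Measure.map_add _ _ measurable_snd]

theorem slice_univ : slice θ univ = θ.snd := by
  rw [slice, univ_prod_univ, Measure.restrict_univ]

theorem slice_apply_univ (hA : MeasurableSet A) : slice θ A univ = θ.fst A := by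
  rw [slice, Measure.snd_apply MeasurableSet.univ, preimage_univ, Measure.restrict_apply_univ,
    Measure.fst_apply hA, prod_univ]

/-- `θ` restricted to the complement of `[0,u]`, projected to the second coordinate. -/
noncomputable def rest (θ : Measure (ℝ × ℝ)) (u : ℝ) : Measure ℝ := slice θ (Icc 0 u)ᶜ

/-- The increment of the primitive curve of `θ` between `u` and `v`. -/
noncomputable def incr (θ : Measure (ℝ × ℝ)) (u v : ℝ) : Measure ℝ := slice θ (Icc 0 v \ Icc 0 u)

theorem primitive_add_rest (u : ℝ) : primitive θ u + rest θ u = θ.snd := by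
  rw [← slice_univ, ← union_compl_self (Icc 0 u), ← slice_add measurableSet_Icc.compl
    disjoint_compl_right]
  rfl

theorem primitive_add_incr {u v : ℝ} (h : u ≤ v) :
    primitive θ u + incr θ u v = primitive θ v := by
  have h1 := slice_add (θ := θ) (measurableSet_Icc.diff measurableSet_Icc)
    (disjoint_sdiff_right (s := Icc (0 : ℝ) u) (t := Icc 0 v))
  have h2 : Icc (0 : ℝ) u ⊆ Icc 0 v := Icc_subset_Icc_right h
  rw [union_sdiff_cancel h2] at h1
  exact h1

theorem incr_add_rest {u v : ℝ} (h : u ≤ v) : incr θ u v + rest θ v = rest θ u := by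
  have hs : Icc 0 u ⊆ Icc 0 v := Icc_subset_Icc_right h
  rw [incr, rest, slice_add measurableSet_Icc.compl
    (disjoint_compl_right.mono_left sdiff_subset), rest]
  congr 1
  ext x
  simp only [mem_union, Set.mem_sdiff, mem_compl_iff]
  have := @hs x
  tauto

variable {μ : Measure ℝ} {μhat : Measure (ℝ × ℝ)}

theorem IsLift.primitive_real_univ (h : IsLift μhat μ) {u : ℝ} (hu : u ∈ Icc (0 : ℝ) 1) :
    (primitive μhat u).real univ = u := by
  have : primitive μhat u univ = unitLebesgue (Icc 0 u) := by
    rw [← h.1]; exact slice_apply_univ measurableSet_Icc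
  rw [Measure.real, this, unitLebesgue, Measure.restrict_apply measurableSet_Icc,
    inter_eq_left.2 (Icc_subset_Icc_right hu.2), Real.volume_Icc, sub_zero,
    ENNReal.toReal_ofReal hu.1]

theorem IsLift.finiteFirstMoment_slice (h : IsLift μhat μ) (hμ : FiniteFirstMoment μ) (A : Set ℝ) :
    FiniteFirstMoment (slice μhat A) :=
  hμ.mono (h.2 ▸ slice_le_snd)

theorem IsLift.incr_real_univ (h : IsLift μhat μ) (hμ : FiniteFirstMoment μ) {u v : ℝ}
    (hu : 0 ≤ u) (huv : u ≤ v) (hv : v ≤ 1) : (incr μhat u v).real univ = v - u := by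
  have h1 := mass_add (h.finiteFirstMoment_slice hμ (Icc 0 u)) (h.finiteFirstMoment_slice hμ
    (Icc 0 v \ Icc 0 u))
  have h2 : slice μhat (Icc 0 u) + slice μhat (Icc 0 v \ Icc 0 u) = primitive μhat v :=
    primitive_add_incr huv
  have h3 := h.primitive_real_univ ⟨hu, huv.trans hv⟩
  rw [h2, h.primitive_real_univ ⟨hu.trans huv, hv⟩] at h1
  rw [incr]
  have h4 : (slice μhat (Icc 0 u)).real univ = u := h3
  linarith

end Slice

/-! ### The curve of shadows -/

section ShadowCurve

variable {μ ν : Measure ℝ} {μhat : Measure (ℝ × ℝ)} {N σ : ℝ → Measure ℝ}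

/-- `N` and `σ` are the curve of shadows of the primitive of `μhat` in `ν`, and its complement. -/
structure IsShadowCurve (μhat : Measure (ℝ × ℝ)) (ν : Measure ℝ) (N σ : ℝ → Measure ℝ) :
    Prop where
  split : ∀ u, IsShadowSplit ν (primitive μhat u) (N u) (σ u)
  order : ∀ u, ConvexOrder (rest μhat u) (σ u)

theorem exists_isShadowCurve (hμν : ConvexOrder μ ν) (h : IsLift μhat μ) :
    ∃ N σ, IsShadowCurve μhat ν N σ := by
  have h1 : ∀ u, ∃ η τ, IsShadowSplit ν (primitive μhat u) η τ ∧ ConvexOrder (rest μhat u) τ :=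
    fun u => exists_isShadowSplit (h.finiteFirstMoment_slice hμν.1 _)
      (h.finiteFirstMoment_slice hμν.1 _) (by
        have : slice μhat (Icc 0 u) + slice μhat (Icc 0 u)ᶜ = μhat.snd := primitive_add_rest u
        change ConvexOrder (slice μhat (Icc 0 u) + slice μhat (Icc 0 u)ᶜ) ν
        rwa [this, h.2])
  choose N σ h1 h2 using h1
  exact ⟨N, σ, h1, h2⟩

namespace IsShadowCurve

theorem finiteFirstMoment (hc : IsShadowCurve μhat ν N σ) (u : ℝ) : FiniteFirstMoment (N u) := (hc.split u).order.2.1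

theorem sub_eq (hc : IsShadowCurve μhat ν N σ) (u : ℝ) : ν - N u = σ u := by
  have := (hc.finiteFirstMoment u).1
  rw [← (hc.split u).add_eq, add_comm, Measure.add_sub_cancel]

/-- Associativity of shadows. Its domination hypothesis is the field `order` at `u`, since the
increment plus the rest after `v` is the rest after `u`. -/
theorem exists_increment (hc : IsShadowCurve μhat ν N σ) (hμ : FiniteFirstMoment μ)
    (h : IsLift μhat μ) {u v : ℝ} (huv : u ≤ v) :
    ∃ δ, IsShadowSplit (σ u) (incr μhat u v) δ (σ v) ∧ N u + δ = N v := by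
  refine (hc.split u).increment (h.finiteFirstMoment_slice hμ _)
    (h.finiteFirstMoment_slice hμ (Icc 0 v)ᶜ) ?_ ?_
  · have := incr_add_rest (θ := μhat) huv
    have h2 := hc.order u
    rwa [← this] at h2
  · have : primitive μhat u + slice μhat (Icc 0 v \ Icc 0 u) = primitive μhat v :=
      primitive_add_incr huv
    exact this ▸ hc.split v

theorem antitone (hc : IsShadowCurve μhat ν N σ) (hμ : FiniteFirstMoment μ)
    (h : IsLift μhat μ) : Antitone σ := fun u v huv => by
  obtain ⟨δ, hδ, -⟩ := hc.exists_increment hμ h huv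
  rw [← hδ.add_eq]
  exact Measure.le_add_left le_rfl

theorem real_univ (hc : IsShadowCurve μhat ν N σ) (h : IsLift μhat μ) {u : ℝ} (hu : u ∈ Icc (0 : ℝ) 1) : (N u).real univ = u :=
  (hc.split u).mass_eq.symm.trans (h.primitive_real_univ hu)

theorem remaining_real_univ (hc : IsShadowCurve μhat ν N σ) (h : IsLift μhat μ)
    [IsProbabilityMeasure ν] {u : ℝ} (hu : u ∈ Icc (0 : ℝ) 1) :
    (σ u).real univ = 1 - u := by
  have h1 := mass_add (hc.finiteFirstMoment u) (hc.split u).remaining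
  rw [(hc.split u).add_eq, hc.real_univ h hu, probReal_univ] at h1
  linarith

theorem eq_one (hc : IsShadowCurve μhat ν N σ) (h : IsLift μhat μ) [IsProbabilityMeasure ν] : N 1 = ν := by
  have h1 := hc.remaining_real_univ h (u := 1) ⟨zero_le_one, le_rfl⟩
  have := (hc.split 1).remaining.1
  rw [sub_self, measureReal_eq_zero_iff, Measure.measure_univ_eq_zero] at h1
  have h2 := (hc.split 1).add_eq
  rwa [h1, add_zero] at h2

end IsShadowCurve

end ShadowCurve

/-! ### The right derivative of the curve of shadows -/

section RightDerivative

variable {c : ℝ → Measure ℝ} {m : Measure ℝ} {u : ℝ}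

theorem Icc_mem_nhdsGT_of_mem_Ico (hu : u ∈ Ico (0 : ℝ) 1) : Icc (0 : ℝ) 1 ∈ 𝓝[>] u := by
  filter_upwards [Ioo_mem_nhdsGT hu.2] with t ht
  exact ⟨hu.1.trans ht.1.le, ht.2.le⟩

theorem HasMeasureDerivAt.tendsto_right (h : HasMeasureDerivAt c m u) (hu : u ∈ Ico (0 : ℝ) 1)
    {f : ℝ → ℝ} (hf : Continuous f) {C : ℝ} (hC : ∀ x, |f x| ≤ C * (1 + |x|)) :
    Tendsto (fun t => (∫ x, f x ∂c t - ∫ x, f x ∂c u) / (t - u)) (𝓝[>] u) (𝓝 (∫ x, f x ∂m)) := by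
  have h1 := (h.2 f hf ⟨C, hC⟩).mono_of_mem_nhdsWithin (Icc_mem_nhdsGT_of_mem_Ico hu)
  rw [hasDerivWithinAt_iff_tendsto_slope' self_notMem_Ioi] at h1
  simpa only [slope_fun_def_field] using h1

variable {μ ν : Measure ℝ} {μhat : Measure (ℝ × ℝ)} {N σ : ℝ → Measure ℝ}

/-- For `t > u` the increment `N t - N u` is a shadow in the fixed measure `σ u` of a measure of
mass `t - u`, so `tendsto_put_shadow` applies. Only the right side is treated: for `t < u` the
increment is a shadow in `σ t`, which moves with `t`. -/
theorem IsShadowCurve.right_derivative [IsProbabilityMeasure ν] (hc : IsShadowCurve μhat ν N σ)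
    (hμ : FiniteFirstMoment μ) (h : IsLift μhat μ) (hu : u ∈ Ico (0 : ℝ) 1)
    (hm : HasMeasureDerivAt (primitive μhat) m u) :
    (∀ᵐ x ∂m, Between (σ u).support x) ∧ ∀ k,
      Tendsto (fun t => (put (N t) k - put (N u) k) / (t - u)) (𝓝[>] u)
        (𝓝 (put (hittingProjection m (σ u).support) k)) := by
  classical
  have hex : ∀ t, ∃ δ, u < t → IsShadowSplit (σ u) (incr μhat u t) δ (σ t) ∧ N u + δ = N t :=
    fun t => by
      by_cases ht : u < t
      · obtain ⟨δ, hδ⟩ := hc.exists_increment hμ h ht.le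
        exact ⟨δ, fun _ => hδ⟩
      · exact ⟨0, fun h => absurd h ht⟩
  choose δ hδ using hex
  have hgt : ∀ᶠ t in 𝓝[>] u, u < t := self_mem_nhdsWithin
  have hle : ∀ᶠ t in 𝓝[>] u, t ≤ 1 :=
    mem_of_superset (Icc_mem_nhdsGT_of_mem_Ico hu) fun t ht => ht.2
  have hh : Tendsto (fun t => t - u) (𝓝[>] u) (𝓝 0) := by
    have : Tendsto (fun t => t - u) (𝓝 u) (𝓝 (u - u)) := tendsto_id.sub_const u
    rw [sub_self] at this
    exact this.mono_left nhdsWithin_le_nhds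
  have hpos : ∀ᶠ t in 𝓝[>] u, 0 < t - u := hgt.mono fun t ht => sub_pos.2 ht
  have hs : ∀ᶠ t in 𝓝[>] u, IsShadowSplit (σ u) (incr μhat u t) (δ t) (σ t) :=
    hgt.mono fun t ht => (hδ t ht).1
  have hα : ∀ᶠ t in 𝓝[>] u, (incr μhat u t).real univ = t - u := by
    filter_upwards [hgt, hle] with t h1 h2
    exact h.incr_real_univ hμ hu.1 h1.le h2
  -- The complement has mass `1 - u`; this is where `u < 1` is needed.
  have hσ0 : σ u ≠ 0 := fun h0 => by
    have := hc.remaining_real_univ h ⟨hu.1, hu.2.le⟩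
    rw [h0] at this
    simp only [measureReal_zero, Pi.zero_apply] at this
    linarith [hu.2]
  have hfm : ∀ A, FiniteFirstMoment (slice μhat A) := h.finiteFirstMoment_slice hμ
  have hincr : ∀ {f : ℝ → ℝ} {C : ℝ}, Continuous f → (∀ x, |f x| ≤ C * (1 + |x|)) →
      Tendsto (fun t => (∫ x, f x ∂incr μhat u t) / (t - u)) (𝓝[>] u) (𝓝 (∫ x, f x ∂m)) := by
    intro f C hf hC
    refine (hm.tendsto_right hu hf hC).congr' (hgt.mono fun t ht => ?_)
    have i1 : Integrable f (primitive μhat u) :=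
      (hfm (Icc 0 u)).integrable_of_le hf.measurable hC
    have i2 : Integrable f (incr μhat u t) := (hfm _).integrable_of_le hf.measurable hC
    simp only [← primitive_add_incr ht.le, integral_add_measure i1 i2, add_sub_cancel_left]
  have hput : ∀ k, Tendsto (fun t => put (incr μhat u t) k / (t - u)) (𝓝[>] u) (𝓝 (put m k)) :=
    fun k => hincr (by fun_prop) (abs_max_sub_le k)
  have hmean := hincr continuous_id (C := 1) (fun x => by
    rw [id, one_mul]; linarith)
  have hm1 : m.real univ = 1 := by
    have h1 := hincr (f := fun _ => 1) continuous_const (C := 1) (fun x => by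
      rw [abs_one, one_mul]; linarith [abs_nonneg x])
    simp only [integral_const, smul_eq_mul, mul_one] at h1
    refine tendsto_nhds_unique h1 (tendsto_const_nhds.congr' ?_)
    filter_upwards [hα, hpos] with t h2 h3
    rw [h2, div_self h3.ne']
  refine ⟨ae_between_of_tendsto hh hpos hs hα hσ0 hm.1 hm1 hput hmean, fun k => ?_⟩
  refine (tendsto_put_shadow hh hpos hs hα hσ0 hm.1 hm1 hput hmean k).congr'
    (hgt.mono fun t ht => ?_)
  simp only
  rw [← (hδ t ht).2, put_add (hc.finiteFirstMoment u) (hδ t ht).1.order.2.1, add_sub_cancel_left]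

/-- The derivative of the curve of shadows is the hitting projection of the derivative of the
primitive curve. -/
theorem IsShadowCurve.eq_hittingProjection [IsProbabilityMeasure ν]
    (hc : IsShadowCurve μhat ν N σ) (hμ : FiniteFirstMoment μ) (h : IsLift μhat μ)
    (hu : u ∈ Ico (0 : ℝ) 1) (hm : HasMeasureDerivAt (primitive μhat) m u) {n : Measure ℝ}
    (hcN : ∀ t ∈ Icc (0 : ℝ) 1, c t = N t) (hn : HasMeasureDerivAt c n u) :
    SupportWithin m (σ u).support ∧ n = hittingProjection m (σ u).support := by
  obtain ⟨h1, h2⟩ := hc.right_derivative hμ h hu hm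
  have hT : IsClosed (σ u).support := Measure.isClosed_support
  have hσ0 : σ u ≠ 0 := fun h0 => by
    have := hc.remaining_real_univ h ⟨hu.1, hu.2.le⟩
    rw [h0] at this
    simp only [measureReal_zero, Pi.zero_apply] at this
    linarith [hu.2]
  have hne := Measure.nonempty_support hσ0
  refine ⟨supportWithin_of_ae_between hT hne h1, eq_of_put hn.1
    (finiteFirstMoment_hittingProjection hT hne h1 hm.1) fun k => ?_⟩
  refine tendsto_nhds_unique (hn.tendsto_right hu (f := fun y => max (k - y) 0) (by fun_prop)
    (abs_max_sub_le k)) ((h2 k).congr' ?_)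
  filter_upwards [Icc_mem_nhdsGT_of_mem_Ico hu] with t ht
  rw [hcN t ht, hcN u ⟨hu.1, hu.2.le⟩, put, put]

end RightDerivative

/-! ### Measurability of the kernel of hitting projections -/

section Kernel

variable {σ : ℝ → Measure ℝ}

theorem measurableSet_pos_of_antitone (hσ : Antitone σ) (B : Set ℝ) :
    MeasurableSet {p : ℝ × ℝ | 0 < σ p.1 B} := by
  have h : Measurable fun u => σ u B := Antitone.measurable fun u v huv => hσ huv B
  exact measurableSet_lt measurable_const (h.comp measurable_fst)

/-- Membership in the support is tested on rational intervals, and the mass of each interval is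
monotone in `u`. -/
theorem measurableSet_mem_support (hσ : Antitone σ) :
    MeasurableSet {p : ℝ × ℝ | p.2 ∈ (σ p.1).support} := by
  have h : {p : ℝ × ℝ | p.2 ∈ (σ p.1).support} =
      ⋂ (q : ℚ) (r : ℚ), {p : ℝ × ℝ | p.2 ≤ q} ∪ {p | (r : ℝ) ≤ p.2} ∪
        {p : ℝ × ℝ | 0 < σ p.1 (Ioo (q : ℝ) r)} := by
    ext p
    simp only [mem_ofPred_eq, mem_iInter, mem_union]
    constructor
    · intro h q r
      by_cases h1 : p.2 ≤ q
      · exact Or.inl (Or.inl h1)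
      by_cases h2 : (r : ℝ) ≤ p.2
      · exact Or.inl (Or.inr h2)
      exact Or.inr ((Measure.mem_support_iff_forall _).1 h _
        (Ioo_mem_nhds (not_le.1 h1) (not_le.1 h2)))
    · intro h
      refine (Measure.mem_support_iff_forall _).2 fun U hU => ?_
      obtain ⟨a, b, hab, hU⟩ := mem_nhds_iff_exists_Ioo_subset.1 hU
      obtain ⟨q, hq1, hq2⟩ := exists_rat_btwn hab.1
      obtain ⟨r, hr1, hr2⟩ := exists_rat_btwn hab.2
      rcases h q r with (h1 | h1) | h1
      · exact absurd h1 (not_le.2 hq2)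
      · exact absurd h1 (not_le.2 hr1)
      · exact h1.trans_le (measure_mono ((Ioo_subset_Ioo hq1.le hr2.le).trans hU))
  rw [h]
  refine MeasurableSet.iInter fun q => MeasurableSet.iInter fun r => ?_
  exact ((measurableSet_le measurable_snd measurable_const).union
    (measurableSet_le measurable_const measurable_snd)).union (measurableSet_pos_of_antitone hσ _)

/-- A support point on one side of `x` is either `x` itself or is detected by a rational interval of
positive mass on that side. -/
theorem measurableSet_between (hσ : Antitone σ) :
    MeasurableSet {p : ℝ × ℝ | Between (σ p.1).support p.2} := by
  have h1 : {p : ℝ × ℝ | ((σ p.1).support ∩ Iic p.2).Nonempty} =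
      {p : ℝ × ℝ | p.2 ∈ (σ p.1).support} ∪
        ⋃ (q : ℚ) (r : ℚ), {p : ℝ × ℝ | (r : ℝ) ≤ p.2} ∩ {p | 0 < σ p.1 (Ioo (q : ℝ) r)} := by
    ext p
    simp only [mem_ofPred_eq, mem_iUnion, mem_union, mem_inter_iff]
    constructor
    · rintro ⟨t, ht, htp⟩
      rcases eq_or_lt_of_le (show t ≤ p.2 from htp) with rfl | hlt
      · exact Or.inl ht
      · obtain ⟨r, hr1, hr2⟩ := exists_rat_btwn hlt
        obtain ⟨q, hq⟩ := exists_rat_lt t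
        exact Or.inr ⟨q, r, hr2.le, (Measure.mem_support_iff_forall _).1 ht _
          (Ioo_mem_nhds hq hr1)⟩
    · rintro (h | ⟨q, r, h2, h3⟩)
      · exact ⟨p.2, h, le_refl (p.2)⟩
      · obtain ⟨t, ht, ht'⟩ := Measure.nonempty_inter_support_of_pos h3
        exact ⟨t, ht', ht.2.le.trans h2⟩
  have h2 : {p : ℝ × ℝ | ((σ p.1).support ∩ Ici p.2).Nonempty} =
      {p : ℝ × ℝ | p.2 ∈ (σ p.1).support} ∪
        ⋃ (q : ℚ) (r : ℚ), {p : ℝ × ℝ | p.2 ≤ (q : ℝ)} ∩ {p | 0 < σ p.1 (Ioo (q : ℝ) r)} := by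
    ext p
    simp only [mem_ofPred_eq, mem_iUnion, mem_union, mem_inter_iff]
    constructor
    · rintro ⟨t, ht, htp⟩
      rcases eq_or_lt_of_le (show p.2 ≤ t from htp) with he | hlt
      · exact Or.inl (he ▸ ht)
      · obtain ⟨q, hq1, hq2⟩ := exists_rat_btwn hlt
        obtain ⟨r, hr⟩ := exists_rat_gt t
        exact Or.inr ⟨q, r, hq1.le, (Measure.mem_support_iff_forall _).1 ht _
          (Ioo_mem_nhds hq2 hr)⟩
    · rintro (h | ⟨q, r, h2, h3⟩)
      · exact ⟨p.2, h, le_refl (p.2)⟩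
      · obtain ⟨t, ht, ht'⟩ := Measure.nonempty_inter_support_of_pos h3
        exact ⟨t, ht', h2.trans ht.1.le⟩
  have e : {p : ℝ × ℝ | Between (σ p.1).support p.2} =
      {p : ℝ × ℝ | ((σ p.1).support ∩ Iic p.2).Nonempty} ∩
        {p : ℝ × ℝ | ((σ p.1).support ∩ Ici p.2).Nonempty} := rfl
  rw [e, h1, h2]
  refine MeasurableSet.inter ?_ ?_ <;>
    refine (measurableSet_mem_support hσ).union
      (MeasurableSet.iUnion fun q => MeasurableSet.iUnion fun r =>
        MeasurableSet.inter ?_ (measurableSet_pos_of_antitone hσ _))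
  · exact measurableSet_le measurable_const measurable_snd
  · exact measurableSet_le measurable_snd measurable_const

/-- The points `(u, x)` for which `x` lies in a gap of the support of `σ u`. -/
def gapSet (σ : ℝ → Measure ℝ) : Set (ℝ × ℝ) :=
  {p | Between (σ p.1).support p.2} ∩ {p | p.2 ∈ (σ p.1).support}ᶜ

theorem measurableSet_gapSet (hσ : Antitone σ) : MeasurableSet (gapSet σ) :=
  (measurableSet_between hσ).inter (measurableSet_mem_support hσ).compl

open Classical in
/-- The left end point of the gap of the support of `σ u` that contains `x`. -/
noncomputable def gapLower (σ : ℝ → Measure ℝ) (p : ℝ × ℝ) : ℝ :=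
  if p ∈ gapSet σ then lowerPoint (σ p.1).support p.2 else p.2

open Classical in
/-- The right end point of the gap of the support of `σ u` that contains `x`. -/
noncomputable def gapUpper (σ : ℝ → Measure ℝ) (p : ℝ × ℝ) : ℝ :=
  if p ∈ gapSet σ then upperPoint (σ p.1).support p.2 else p.2

/-- In a gap containing `x`, the left end point exceeds `c` iff some `(c, r)` with rational `r ≤ x`
has positive mass. -/
theorem measurable_gapLower (hσ : Antitone σ) : Measurable (gapLower σ) := by
  refine measurable_of_Ioi fun c => ?_
  have h : gapLower σ ⁻¹' Ioi c =
      (gapSet σ ∩ ⋃ r : ℚ, {p : ℝ × ℝ | (r : ℝ) ≤ p.2} ∩ {p | 0 < σ p.1 (Ioo c r)}) ∪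
        ((gapSet σ)ᶜ ∩ {p : ℝ × ℝ | c < p.2}) := by
    ext p
    by_cases hp : p ∈ gapSet σ
    · have hT : IsClosed (σ p.1).support := Measure.isClosed_support
      have h1 := lowerPoint_lt hT hp.1 hp.2
      have h2 := lowerPoint_mem hT hp.1
      have h3 := lt_upperPoint hT hp.1 hp.2
      simp only [mem_preimage, gapLower, mem_Ioi, mem_union, mem_inter_iff, hp,
        true_and, mem_iUnion, mem_ofPred_eq, mem_compl_iff, not_true_eq_false, false_and, or_false]
      constructor
      · intro hc
        obtain ⟨r, hr1, hr2⟩ := exists_rat_btwn h1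
        exact ⟨r, hr2.le, (Measure.mem_support_iff_forall _).1 h2.1 _ (Ioo_mem_nhds hc hr1)⟩
      · rintro ⟨r, hr, hpos⟩
        obtain ⟨t, ht, ht'⟩ := Measure.nonempty_inter_support_of_pos hpos
        rcases le_lowerPoint_or_upperPoint_le (x := p.2) ht' with h4 | h4
        · exact ht.1.trans_le h4
        · linarith [ht.2]
    · simp [gapLower, hp]
  rw [h]
  exact ((measurableSet_gapSet hσ).inter (MeasurableSet.iUnion fun r =>
    (measurableSet_le measurable_const measurable_snd).inter
      (measurableSet_pos_of_antitone hσ _))).union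
    ((measurableSet_gapSet hσ).compl.inter (measurableSet_lt measurable_const measurable_snd))

theorem measurable_gapUpper (hσ : Antitone σ) : Measurable (gapUpper σ) := by
  refine measurable_of_Iio fun c => ?_
  have h : gapUpper σ ⁻¹' Iio c =
      (gapSet σ ∩ ⋃ r : ℚ, {p : ℝ × ℝ | p.2 ≤ (r : ℝ)} ∩ {p | 0 < σ p.1 (Ioo (r : ℝ) c)}) ∪
        ((gapSet σ)ᶜ ∩ {p : ℝ × ℝ | p.2 < c}) := by
    ext p
    by_cases hp : p ∈ gapSet σ
    · have hT : IsClosed (σ p.1).support := Measure.isClosed_support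
      have h1 := lowerPoint_lt hT hp.1 hp.2
      have h2 := upperPoint_mem hT hp.1
      have h3 := lt_upperPoint hT hp.1 hp.2
      simp only [mem_preimage, gapUpper, mem_Iio, mem_union, mem_inter_iff, hp,
        true_and, mem_iUnion, mem_ofPred_eq, mem_compl_iff, not_true_eq_false, false_and, or_false]
      constructor
      · intro hc
        obtain ⟨r, hr1, hr2⟩ := exists_rat_btwn h3
        exact ⟨r, hr1.le, (Measure.mem_support_iff_forall _).1 h2.1 _ (Ioo_mem_nhds hr2 hc)⟩
      · rintro ⟨r, hr, hpos⟩
        obtain ⟨t, ht, ht'⟩ := Measure.nonempty_inter_support_of_pos hpos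
        rcases le_lowerPoint_or_upperPoint_le (x := p.2) ht' with h4 | h4
        · linarith [ht.1]
        · exact h4.trans_lt ht.2
    · simp [gapUpper, hp]
  rw [h]
  exact ((measurableSet_gapSet hσ).inter (MeasurableSet.iUnion fun r =>
    (measurableSet_le measurable_snd measurable_const).inter
      (measurableSet_pos_of_antitone hσ _))).union
    ((measurableSet_gapSet hσ).compl.inter (measurableSet_lt measurable_snd measurable_const))

open Classical in
/-- The kernel `(u, x) ↦ P_{T(u)}(x, ·)` with `T(u)` the support of `σ u`, extended by Dirac
measures to the points outside `[inf T(u), sup T(u)]`. -/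
noncomputable def shadowKernel (σ : ℝ → Measure ℝ) (hσ : Antitone σ) : Kernel (ℝ × ℝ) ℝ where
  toFun p := if p ∈ gapSet σ then
      ENNReal.ofReal ((gapUpper σ p - p.2) / (gapUpper σ p - gapLower σ p)) •
        Measure.dirac (gapLower σ p) +
      ENNReal.ofReal ((p.2 - gapLower σ p) / (gapUpper σ p - gapLower σ p)) •
        Measure.dirac (gapUpper σ p)
    else Measure.dirac p.2
  measurable' := by
    have h1 := measurable_gapLower hσ
    have h2 := measurable_gapUpper hσ
    refine Measurable.ite (measurableSet_gapSet hσ) ?_ (Measure.measurable_dirac.comp measurable_snd)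
    refine Measure.measurable_of_measurable_coe _ fun s hs => ?_
    have hind : Measurable (s.indicator (1 : ℝ → ENNReal)) := measurable_one.indicator hs
    simp only [Measure.coe_add, Measure.coe_smul, Pi.add_apply, Pi.smul_apply, smul_eq_mul,
      Measure.dirac_apply' _ hs]
    exact (((h2.sub measurable_snd).div (h2.sub h1)).ennreal_ofReal.mul (hind.comp h1)).add
      (((measurable_snd.sub h1).div (h2.sub h1)).ennreal_ofReal.mul (hind.comp h2))

variable {hσ : Antitone σ}

theorem shadowKernel_of_between {p : ℝ × ℝ} (hp : Between (σ p.1).support p.2) :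
    shadowKernel σ hσ p = dilation (σ p.1).support p.2 := by
  by_cases h : p.2 ∈ (σ p.1).support
  · rw [dilation_of_mem h]
    exact if_neg fun h' => h'.2 h
  · have hg : p ∈ gapSet σ := ⟨hp, h⟩
    rw [dilation_of_notMem h]
    have h1 : gapLower σ p = lowerPoint (σ p.1).support p.2 := if_pos hg
    have h2 : gapUpper σ p = upperPoint (σ p.1).support p.2 := if_pos hg
    rw [← h1, ← h2]
    exact if_pos hg

theorem shadowKernel_of_not_between {p : ℝ × ℝ} (hp : ¬ Between (σ p.1).support p.2) :
    shadowKernel σ hσ p = Measure.dirac p.2 :=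
  if_neg fun h => hp h.1

instance : IsMarkovKernel (shadowKernel σ hσ) := ⟨fun p => by
  by_cases hp : Between (σ p.1).support p.2
  · rw [shadowKernel_of_between hp]
    exact isProbabilityMeasure_dilation Measure.isClosed_support hp
  · rw [shadowKernel_of_not_between hp]
    infer_instance⟩

theorem integral_shadowKernel (p : ℝ × ℝ) : ∫ y, y ∂shadowKernel σ hσ p = p.2 := by
  by_cases hp : Between (σ p.1).support p.2
  · rw [shadowKernel_of_between hp]
    exact integral_id_dilation Measure.isClosed_support hp
  · rw [shadowKernel_of_not_between hp, integral_dirac]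

end Kernel

/-! ### Integrating a right derivative -/

section FTC

/-- A Lipschitz function is the integral of its right derivative. -/
theorem integral_eq_sub_of_lipschitz_of_right_deriv {G g : ℝ → ℝ} {K : NNReal} {a b : ℝ}
    (hab : a ≤ b) (hG : LipschitzOnWith K G (Icc a b))
    (hg : ∀ᵐ t ∂volume.restrict (Icc a b), HasDerivWithinAt G (g t) (Ioi t) t) :
    ∫ t in a..b, g t = G b - G a := by
  have hac : AbsolutelyContinuousOnInterval G a b :=
    LipschitzOnWith.absolutelyContinuousOnInterval (by rwa [uIcc_of_le hab])
  rw [← hac.integral_deriv_eq_sub]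
  rw [ae_restrict_iff' measurableSet_Icc] at hg
  refine intervalIntegral.integral_congr_ae ?_
  filter_upwards [hg, hac.ae_differentiableAt] with t h1 h2 ht
  have ht' : t ∈ uIcc a b := uIoc_subset_uIcc ht
  have h3 := (h2 ht').hasDerivAt.hasDerivWithinAt (s := Ioi t)
  rw [uIcc_of_le hab] at ht'
  exact (uniqueDiffWithinAt_Ioi t).eq_deriv _ (h1 ht') h3

end FTC

/-! ### Projections of lifted plans -/

section Projections

variable {πhat : Measure (ℝ × ℝ × ℝ)} {μhat : Measure (ℝ × ℝ)}

theorem primitive_projUX (u : ℝ) : (primitive πhat u).fst = primitive (projUX πhat) u := by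
  ext A hA
  have hf : Measurable fun p : ℝ × ℝ × ℝ => (p.1, p.2.1) := by fun_prop
  rw [Measure.fst_apply hA, primitive_apply u (measurable_fst hA), primitive_apply u hA, projUX,
    Measure.map_apply hf (measurableSet_Icc.prod hA)]
  rfl

theorem primitive_projUY (u : ℝ) : (primitive πhat u).snd = primitive (projUY πhat) u := by
  ext A hA
  have hf : Measurable fun p : ℝ × ℝ × ℝ => (p.1, p.2.2) := by fun_prop
  rw [Measure.snd_apply hA, primitive_apply u (measurable_snd hA), primitive_apply u hA, projUY,
    Measure.map_apply hf (measurableSet_Icc.prod hA)]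
  rfl

theorem fst_projUX : (projUX πhat).fst = πhat.fst := by
  rw [projUX, Measure.fst, Measure.map_map measurable_fst (by fun_prop)]
  rfl

theorem fst_projUY : (projUY πhat).fst = πhat.fst := by
  rw [projUY, Measure.fst, Measure.map_map measurable_fst (by fun_prop)]
  rfl

theorem snd_projUY : (projUY πhat).snd = projY πhat := by
  rw [projUY, Measure.snd, Measure.map_map measurable_snd (by fun_prop)]
  rfl

theorem primitive_one {θ : Measure (ℝ × ℝ)} (h : θ.fst = unitLebesgue) :
    primitive θ 1 = θ.snd := by
  ext A hA
  rw [primitive_apply 1 hA, Measure.snd_apply hA]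
  refine measure_congr ?_
  have h1 : ∀ᵐ p ∂θ, p.1 ∈ Icc (0 : ℝ) 1 := by
    have : ∀ᵐ u ∂θ.fst, u ∈ Icc (0 : ℝ) 1 := by
      rw [h]
      exact ae_restrict_mem measurableSet_Icc
    exact ae_of_ae_map measurable_fst.aemeasurable this
  filter_upwards [h1] with p hp
  exact propext ⟨fun h => h.2, fun h => ⟨hp, h⟩⟩

end Projections

/-! ### Existence of the lifted shadow coupling -/

section Existence

variable {μ ν : Measure ℝ} {μhat : Measure (ℝ × ℝ)} {N σ : ℝ → Measure ℝ} {κ : Kernel (ℝ × ℝ) ℝ}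
  {κμ : Kernel ℝ ℝ}

theorem IsLift.isProbabilityMeasure (h : IsLift μhat μ) : IsProbabilityMeasure μhat := by
  have h1 : IsProbabilityMeasure μhat.fst := by rw [h.1]; infer_instance
  constructor
  rw [← Measure.fst_univ, measure_univ]

theorem IsLift.isDisintegration_condKernel (h : IsLift μhat μ) :
    have := h.isProbabilityMeasure
    IsDisintegration μhat μhat.condKernel := by
  have := h.isProbabilityMeasure
  refine ⟨inferInstance, ?_⟩
  rw [← h.1]
  exact μhat.disintegrate μhat.condKernel

/-- The lifted plan with given disintegration. -/
noncomputable def planOf (μhat : Measure (ℝ × ℝ)) (κ : Kernel (ℝ × ℝ) ℝ) : Measure (ℝ × ℝ × ℝ) :=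
  (μhat ⊗ₘ κ).map MeasurableEquiv.prodAssoc

theorem projUX_planOf [SFinite μhat] [IsMarkovKernel κ] : projUX (planOf μhat κ) = μhat := by
  rw [projUX, planOf, Measure.map_map (by fun_prop) MeasurableEquiv.prodAssoc.measurable]
  exact Measure.fst_compProd μhat κ

theorem projUY_planOf_apply [SFinite μhat] [IsMarkovKernel κ] {S : Set (ℝ × ℝ)}
    (hS : MeasurableSet S) :
    projUY (planOf μhat κ) S = ∫⁻ p, κ p {y | (p.1, y) ∈ S} ∂μhat := by
  have hf : Measurable fun p : ℝ × ℝ × ℝ => (p.1, p.2.2) := by fun_prop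
  rw [projUY, planOf, Measure.map_map hf MeasurableEquiv.prodAssoc.measurable,
    Measure.map_apply (hf.comp MeasurableEquiv.prodAssoc.measurable) hS,
    Measure.compProd_apply ((hf.comp MeasurableEquiv.prodAssoc.measurable) hS)]
  rfl

theorem isDisintegration_projUY_planOf [IsMarkovKernel κ] (h : IsDisintegration μhat κμ) :
    IsDisintegration (projUY (planOf μhat κ)) ((κμ ⊗ₖ κ).map Prod.snd) := by
  have := h.1
  refine ⟨Kernel.IsMarkovKernel.map _ measurable_snd, ?_⟩
  rw [planOf, ← h.2, Measure.compProd_assoc', Measure.compProd_map measurable_snd]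
  rfl

theorem map_compProd_shadowKernel [IsMarkovKernel κμ] {hσ : Antitone σ} {t : ℝ}
    (ht : ∀ᵐ x ∂κμ t, Between (σ t).support x) :
    (κμ ⊗ₖ shadowKernel σ hσ).map Prod.snd t = hittingProjection (κμ t) (σ t).support := by
  ext B hB
  rw [Kernel.map_apply' _ measurable_snd _ hB, Kernel.compProd_apply (measurable_snd hB),
    hittingProjection_apply _ Measure.isClosed_support.measurableSet hB]
  refine lintegral_congr_ae (ht.mono fun x hx => ?_)
  simp only
  rw [shadowKernel_of_between hx]
  rfl

/-- Increments of the curve have mass `|t - s|`, and the difference of the two payoffs is bounded by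
`|k - l|`. A single payoff is unbounded, so this argument needs the difference. -/
theorem IsShadowCurve.lipschitz (hc : IsShadowCurve μhat ν N σ)
    (hμ : FiniteFirstMoment μ) (h : IsLift μhat μ) (k l : ℝ) :
    LipschitzOnWith |k - l|.toNNReal (fun t => put (N t) k - put (N t) l) (Icc 0 1) := by
  refine LipschitzOnWith.of_dist_le_mul fun s hs t ht => ?_
  rw [Real.coe_toNNReal _ (abs_nonneg _)]
  wlog hst : s ≤ t generalizing s t
  · rw [dist_comm, dist_comm s]
    exact this t ht s hs (le_of_not_ge hst)
  obtain ⟨δ, hδ, hN⟩ := hc.exists_increment hμ h hst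
  have hδf := hδ.order.2.1
  have := hδf.1
  have hmass : δ.real univ = t - s := hδ.mass_eq.symm.trans (h.incr_real_univ hμ hs.1 hst ht.2)
  rw [← hN, put_add (hc.finiteFirstMoment s) hδf, put_add (hc.finiteFirstMoment s) hδf,
    dist_comm, Real.dist_eq, Real.dist_eq, abs_sub_comm s t, abs_of_nonneg (sub_nonneg.2 hst),
    ← hmass, show put (N s) k + put δ k - (put (N s) l + put δ l) - (put (N s) k - put (N s) l) =
      put δ k - put δ l by ring, put, put,
    ← integral_sub (hδf.integrable_put k) (hδf.integrable_put l)]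
  exact (norm_integral_le_of_norm_le_const (f := fun y => max (k - y) 0 - max (l - y) 0)
    (C := |k - l|) (ae_of_all _ fun y => abs_max_sub_max_le_abs_sub k l y))

theorem ae_mem_Ico : ∀ᵐ u ∂unitLebesgue, u ∈ Ico (0 : ℝ) 1 := by
  rw [unitLebesgue, ← restrict_Ico_eq_restrict_Icc]
  exact ae_restrict_mem measurableSet_Ico

theorem IsShadowCurve.ae_between [IsProbabilityMeasure ν] (hc : IsShadowCurve μhat ν N σ)
    (hμ : FiniteFirstMoment μ) (h : IsLift μhat μ) (hκ : IsDisintegration μhat κμ) :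
    ∀ᵐ t ∂unitLebesgue, ∀ᵐ x ∂κμ t, Between (σ t).support x := by
  filter_upwards [ae_hasMeasureDerivAt hκ (by rw [h.2]; exact hμ), ae_mem_Ico] with t h1 h2
  exact (hc.right_derivative hμ h h2 h1).1

theorem IsShadowCurve.ae_between_lift [IsProbabilityMeasure ν] (hc : IsShadowCurve μhat ν N σ)
    (hμ : FiniteFirstMoment μ) (h : IsLift μhat μ) :
    ∀ᵐ p ∂μhat, Between (σ p.1).support p.2 := by
  have := h.isProbabilityMeasure
  have hκ := h.isDisintegration_condKernel
  have h1 := hc.ae_between hμ h hκ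
  have h2 := Measure.ae_compProd_of_ae_ae (measurableSet_between (hc.antitone hμ h)) h1
  rwa [hκ.2] at h2

/-- The plan obtained from the hitting projections has the shadows as second marginals. -/
theorem IsShadowCurve.primitive_projUY_planOf [IsProbabilityMeasure ν]
    (hc : IsShadowCurve μhat ν N σ) (hμ : FiniteFirstMoment μ) (h : IsLift μhat μ) {u : ℝ}
    (hu : u ∈ Icc (0 : ℝ) 1) :
    primitive (projUY (planOf μhat (shadowKernel σ (hc.antitone hμ h)))) u = N u := by
  have := h.isProbabilityMeasure
  set κμ := μhat.condKernel
  have hκ : IsDisintegration μhat κμ := h.isDisintegration_condKernel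
  set κ := shadowKernel σ (hc.antitone hμ h)
  have hθ := isDisintegration_projUY_planOf (κ := κ) hκ
  set θ := projUY (planOf μhat κ)
  have hθp : IsProbabilityMeasure θ := by
    have := hθ.1
    rw [← hθ.2]
    infer_instance
  have hfin : IsFiniteMeasure (primitive θ u) := isFiniteMeasure_of_le _ (primitive_le_snd u)
  have hNf := hc.finiteFirstMoment u
  have := hNf.1
  refine eq_of_integral_max_sub_max fun k l => ?_
  rw [integral_primitive hθ (integrable_max_sub_max k l) hu,
    integral_sub (hNf.integrable_put k) (hNf.integrable_put l)]
  have hN0 : ∀ k, put (N 0) k = 0 := fun k => by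
    have h1 := hc.real_univ h (u := 0) ⟨le_rfl, zero_le_one⟩
    have := (hc.finiteFirstMoment 0).1
    rw [measureReal_eq_zero_iff, Measure.measure_univ_eq_zero] at h1
    rw [h1, put, integral_zero_measure]
  -- The integrand is the payoff difference under the disintegration of the plan, which for almost
  -- every `t` is the hitting projection, hence the right derivative of the shadow curve.
  have hftc := integral_eq_sub_of_lipschitz_of_right_deriv
    (g := fun t => ∫ y, (max (k - y) 0 - max (l - y) 0) ∂((κμ ⊗ₖ κ).map Prod.snd) t) hu.1
    ((hc.lipschitz hμ h k l).mono (Icc_subset_Icc_right hu.2)) ?_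
  · rw [hftc, hN0, hN0, sub_self, sub_zero]
    rfl
  · refine ae_restrict_of_ae_restrict_of_subset (Icc_subset_Icc_right hu.2) ?_
    have hder := ae_hasMeasureDerivAt hκ (by rw [h.2]; exact hμ)
    filter_upwards [hder, ae_mem_Ico] with t h1 h2
    obtain ⟨h3, h4⟩ := hc.right_derivative hμ h h2 h1
    have hT : IsClosed (σ t).support := Measure.isClosed_support
    rw [map_compProd_shadowKernel h3]
    have hne : (σ t).support.Nonempty := Measure.nonempty_support fun h0 => by
      have := hc.remaining_real_univ h ⟨h2.1, h2.2.le⟩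
      rw [h0] at this
      simp only [measureReal_zero, Pi.zero_apply] at this
      linarith [h2.2]
    have hP := finiteFirstMoment_hittingProjection hT hne h3 h1.1
    rw [integral_sub (hP.integrable_put k) (hP.integrable_put l),
      hasDerivWithinAt_iff_tendsto_slope' self_notMem_Ioi]
    refine ((h4 k).sub (h4 l)).congr fun s => ?_
    rw [slope_def_field, ← sub_div]
    congr 1
    ring

theorem IsShadowCurve.isLiftedShadowCoupling [IsProbabilityMeasure ν]
    (hc : IsShadowCurve μhat ν N σ) (hμ : FiniteFirstMoment μ) (h : IsLift μhat μ) :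
    IsLiftedShadowCoupling μhat ν (planOf μhat (shadowKernel σ (hc.antitone hμ h))) := by
  have := h.isProbabilityMeasure
  set κ := shadowKernel σ (hc.antitone hμ h)
  refine ⟨⟨projUX_planOf, ?_, κ, inferInstance, rfl, ae_of_all _ integral_shadowKernel⟩,
    fun u hu => ⟨?_, ?_⟩⟩
  · rw [← snd_projUY, ← primitive_one, hc.primitive_projUY_planOf hμ h ⟨zero_le_one, le_rfl⟩,
      hc.eq_one h]
    rw [fst_projUY, ← fst_projUX, projUX_planOf, h.1]
  · rw [primitive_projUX, projUX_planOf]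
  · rw [primitive_projUY, hc.primitive_projUY_planOf hμ h hu]
    exact (hc.split u).isShadow

end Existence

/-! ### Uniqueness by strict convexity -/

section Uniqueness

/-- Strict Cauchy–Schwarz for `(1, x)` and `(1, y)`. The function `√(1 + y²)` serves as a strictly
convex function of linear growth, so that a finite first moment makes it integrable. -/
theorem tangent_lt_sqrt {x y : ℝ} (h : x ≠ y) :
    √(1 + x ^ 2) + x / √(1 + x ^ 2) * (y - x) < √(1 + y ^ 2) := by
  have hx : 0 < √(1 + x ^ 2) := Real.sqrt_pos.2 (by positivity)
  have hy : 0 < √(1 + y ^ 2) := Real.sqrt_pos.2 (by positivity)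
  have hx2 := Real.sq_sqrt (show 0 ≤ 1 + x ^ 2 by positivity)
  have hy2 := Real.sq_sqrt (show 0 ≤ 1 + y ^ 2 by positivity)
  have h1 : 1 + x * y < √(1 + x ^ 2) * √(1 + y ^ 2) := by
    refine lt_of_pow_lt_pow_left₀ 2 (by positivity) ?_
    rw [mul_pow, hx2, hy2]
    nlinarith [sq_pos_of_ne_zero (sub_ne_zero.2 h)]
  have h2 : √(1 + x ^ 2) + x / √(1 + x ^ 2) * (y - x) = (1 + x * y) / √(1 + x ^ 2) := by
    rw [eq_div_iff hx.ne', add_mul, ← sq, hx2]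
    field_simp
    ring
  rw [h2, div_lt_iff₀ hx]
  linarith

theorem abs_sqrt_le (y : ℝ) : |√(1 + y ^ 2)| ≤ 1 * (1 + |y|) := by
  rw [abs_of_nonneg (Real.sqrt_nonneg _), one_mul]
  refine Real.sqrt_le_iff.2 ⟨by positivity, ?_⟩
  nlinarith [sq_abs y, abs_nonneg y]

variable {T : Set ℝ} {x : ℝ}

/-- The line through the points of the graph of `√(1 + y²)` over the atoms of `P_T(x, ·)`. -/
theorem exists_line (hT : IsClosed T) (hx : Between T x) : ∃ s t : ℝ,
    (∀ y ∈ T, s * y + t ≤ √(1 + y ^ 2)) ∧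
    (∀ y ∈ T, s * y + t = √(1 + y ^ 2) → (x ∈ T → y = x) ∧
      (x ∉ T → y = lowerPoint T x ∨ y = upperPoint T x)) ∧
    ∫ y, √(1 + y ^ 2) ∂dilation T x = s * x + t := by
  have htan : ∀ a y : ℝ, √(1 + a ^ 2) + a / √(1 + a ^ 2) * (y - a) ≤ √(1 + y ^ 2) := fun a y => by
    rcases eq_or_ne a y with rfl | hne
    · simp
    · exact (tangent_lt_sqrt hne).le
  by_cases hxT : x ∈ T
  · refine ⟨x / √(1 + x ^ 2), √(1 + x ^ 2) - x / √(1 + x ^ 2) * x, fun y _ => ?_,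
      fun y _ he => ?_, ?_⟩
    · linarith [htan x y]
    · refine ⟨fun _ => ?_, fun h => absurd hxT h⟩
      by_contra hne
      linarith [tangent_lt_sqrt (Ne.symm hne)]
    · rw [dilation_of_mem hxT, integral_dirac]
      ring
  · have h1 := lowerPoint_lt hT hx hxT
    have h2 := lt_upperPoint hT hx hxT
    rw [integral_dilation hT hx hxT]
    have hle : ∀ y ∈ T, y ≤ lowerPoint T x ∨ upperPoint T x ≤ y :=
      fun y hy => le_lowerPoint_or_upperPoint_le hy
    set l := lowerPoint T x
    set r := upperPoint T x
    set φ : ℝ → ℝ := fun y => √(1 + y ^ 2) with hφ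
    have hlr : 0 < r - l := by linarith
    set s := (φ r - φ l) / (r - l) with hs
    have hs' : s * (r - l) = φ r - φ l := div_mul_cancel₀ _ hlr.ne'
    -- Outside `[l, r]` the function lies above its tangent at the nearer end point, and strict
    -- convexity puts the chord slope `s` strictly between the two tangent slopes.
    have hstrict : ∀ y, y < l ∨ r < y → s * y + (φ l - s * l) < φ y := by
      intro y hy
      rcases hy with hy | hy
      · have a1 : φ l + l / φ l * (r - l) < φ r := tangent_lt_sqrt (by linarith)
        have a2 : φ l + l / φ l * (y - l) < φ y := tangent_lt_sqrt (by linarith)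
        have a3 : l / φ l < s := by
          rw [hs, lt_div_iff₀ hlr]; linarith
        nlinarith
      · have a1 : φ r + r / φ r * (l - r) < φ l := tangent_lt_sqrt (by linarith)
        have a2 : φ r + r / φ r * (y - r) < φ y := tangent_lt_sqrt (by linarith)
        have a3 : s < r / φ r := by
          rw [hs, div_lt_iff₀ hlr]; linarith
        nlinarith
    refine ⟨s, φ l - s * l, fun y hy => ?_, fun y hy he => ?_, ?_⟩
    · rcases hle y hy with h3 | h3
      · rcases eq_or_lt_of_le h3 with rfl | h4
        · linarith
        · exact (hstrict y (Or.inl h4)).le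
      · rcases eq_or_lt_of_le h3 with rfl | h4
        · change s * r + (φ l - s * l) ≤ φ r
          linarith
        · exact (hstrict y (Or.inr h4)).le
    · refine ⟨fun h => absurd h hxT, fun _ => ?_⟩
      by_contra hne
      push Not at hne
      refine (hstrict y ?_).ne he
      rcases hle y hy with h3 | h3
      · exact Or.inl (lt_of_le_of_ne h3 hne.1)
      · exact Or.inr (lt_of_le_of_ne h3 hne.2.symm)
    · change (r - x) / (r - l) * φ l + (x - l) / (r - l) * φ r = _
      have : φ r = φ l + s * (r - l) := by linarith
      rw [this]
      field_simp
      ring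

variable {ρ : Measure ℝ}

/-- Among the measures on `T` with barycenter `x`, the measure `P_T(x, ·)` is the only minimizer
of the integral of `√(1 + y²)`. -/
theorem dilation_minimal [IsProbabilityMeasure ρ] (hT : IsClosed T) (hx : Between T x)
    (hρT : ρ Tᶜ = 0) (hρ : FiniteFirstMoment ρ) (hbar : ∫ y, y ∂ρ = x) :
    ∫ y, √(1 + y ^ 2) ∂dilation T x ≤ ∫ y, √(1 + y ^ 2) ∂ρ ∧
      (∫ y, √(1 + y ^ 2) ∂dilation T x = ∫ y, √(1 + y ^ 2) ∂ρ → ρ = dilation T x) := by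
  obtain ⟨s, t, h1, h2, h3⟩ := exists_line hT hx
  have hφ : Integrable (fun y => √(1 + y ^ 2)) ρ := hρ.integrable_of_le (by fun_prop) abs_sqrt_le
  have hl : Integrable (fun y => s * y + t) ρ := (hρ.2.const_mul s).add (integrable_const t)
  have hint : ∫ y, (√(1 + y ^ 2) - (s * y + t)) ∂ρ = ∫ y, √(1 + y ^ 2) ∂ρ - (s * x + t) := by
    rw [integral_sub hφ hl, integral_add (hρ.2.const_mul s) (integrable_const t),
      integral_const_mul, hbar, integral_const, probReal_univ, one_smul]
  have haeT : ∀ᵐ y ∂ρ, y ∈ T := (measure_eq_zero_iff_ae_notMem.1 hρT).mono fun y hy => not_not.1 hy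
  have hnn : 0 ≤ᵐ[ρ] fun y => √(1 + y ^ 2) - (s * y + t) :=
    haeT.mono fun y hy => sub_nonneg.2 (h1 y hy)
  have hge := integral_nonneg_of_ae hnn
  rw [hint] at hge
  refine ⟨by rw [h3]; linarith, fun he => ?_⟩
  rw [he] at h3
  rw [h3, sub_self] at hint
  -- Equality of the integrals forces `ρ` onto the contact points of the line, which are the atoms
  -- of `P_T(x, ·)`; the barycenter then fixes the weights.
  have hz := (integral_eq_zero_iff_of_nonneg_ae hnn (hφ.sub hl)).1 hint
  have hprob := isProbabilityMeasure_dilation hT hx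
  refine eq_of_put hρ ⟨inferInstance, integrable_dilation _⟩ fun k => ?_
  by_cases hxT : x ∈ T
  · rw [dilation_of_mem hxT, put, put, integral_dirac, integral_congr_ae (g := fun _ => max (k - x) 0)]
    · simp
    · filter_upwards [hz, haeT] with y hy hyT
      rw [(h2 y hyT (sub_eq_zero.1 hy).symm).1 hxT]
  · have l1 := lowerPoint_lt hT hx hxT
    have l2 := lt_upperPoint hT hx hxT
    rw [put, put, integral_dilation hT hx hxT]
    set l := lowerPoint T x
    set r := upperPoint T x
    have hlr : r - l ≠ 0 := by linarith
    -- The affine function that agrees with the put payoff at `l` and `r`; its integral depends only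
    -- on the barycenter.
    rw [integral_congr_ae (g := fun y => (max (k - r) 0 - max (k - l) 0) / (r - l) * y +
      (r * max (k - l) 0 - l * max (k - r) 0) / (r - l))]
    · rw [integral_add (hρ.2.const_mul _) (integrable_const _), integral_const_mul, hbar,
        integral_const, probReal_univ, one_smul]
      field_simp
      ring
    · filter_upwards [hz, haeT] with y hy hyT
      rcases (h2 y hyT (sub_eq_zero.1 hy).symm).2 hxT with rfl | rfl
      · field_simp; ring
      · field_simp; ring

/-- For fixed `B` the finite measure `A ↦ θ (A × B)` is determined on half-lines. As the first
marginal lives on `[0, 1]`, its value on `Iic u` is the primitive at `min u 1`, which vanishes for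
`u < 0`. -/
theorem projUY_eq_of_primitive {θ θ' : Measure (ℝ × ℝ)} (h : θ.fst = unitLebesgue)
    (h' : θ'.fst = unitLebesgue) (hp : ∀ u ∈ Icc (0 : ℝ) 1, primitive θ u = primitive θ' u) :
    θ = θ' := by
  have hfin : ∀ {θ : Measure (ℝ × ℝ)}, θ.fst = unitLebesgue → IsFiniteMeasure θ := fun h => by
    refine ⟨?_⟩
    rw [← Measure.fst_univ, h]
    exact measure_lt_top _ _
  have := hfin h
  have := hfin h'
  have hIic : ∀ {θ : Measure (ℝ × ℝ)}, θ.fst = unitLebesgue → ∀ u (B : Set ℝ), MeasurableSet B →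
      θ (Iic u ×ˢ B) = primitive θ (min u 1) B := fun {θ} h u B hB => by
    rw [primitive_apply _ hB]
    refine measure_congr ?_
    have h1 : ∀ᵐ p ∂θ, p.1 ∈ Icc (0 : ℝ) 1 := by
      have : ∀ᵐ u ∂θ.fst, u ∈ Icc (0 : ℝ) 1 := by
        rw [h]
        exact ae_restrict_mem measurableSet_Icc
      exact ae_of_ae_map measurable_fst.aemeasurable this
    filter_upwards [h1] with p hp
    exact propext ⟨fun h => ⟨⟨hp.1, le_min h.1 hp.2⟩, h.2⟩,
      fun h => ⟨h.1.2.trans (min_le_left _ _), h.2⟩⟩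
  refine Measure.ext_prod fun {A B} hA hB => ?_
  have hmeas : ((θ.restrict (univ ×ˢ B)).fst) = ((θ'.restrict (univ ×ˢ B)).fst) := by
    refine Measure.ext_of_Iic _ _ fun u => ?_
    rw [Measure.fst_apply measurableSet_Iic, Measure.fst_apply measurableSet_Iic,
      Measure.restrict_apply (measurable_fst measurableSet_Iic),
      Measure.restrict_apply (measurable_fst measurableSet_Iic)]
    have e : (Prod.fst ⁻¹' Iic u ∩ univ ×ˢ B : Set (ℝ × ℝ)) = Iic u ×ˢ B := by
      ext p; simp
    rw [e, hIic h u B hB, hIic h' u B hB]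
    rcases le_or_gt 0 (min u 1) with h0 | h0
    · rw [hp _ ⟨h0, min_le_right _ _⟩]
    · rw [primitive_apply _ hB, primitive_apply _ hB, Icc_eq_empty (not_le.2 h0)]
      simp
  have e : (Prod.fst ⁻¹' A ∩ univ ×ˢ B : Set (ℝ × ℝ)) = A ×ˢ B := by
    ext p; simp
  have := DFunLike.congr_fun hmeas A
  rwa [Measure.fst_apply hA, Measure.fst_apply hA, Measure.restrict_apply (measurable_fst hA),
    Measure.restrict_apply (measurable_fst hA), e] at this

variable {μ ν : Measure ℝ} {μhat : Measure (ℝ × ℝ)} {N σ : ℝ → Measure ℝ}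

theorem IsShadowCurve.primitive_snd_eq (hc : IsShadowCurve μhat ν N σ)
    {πhat : Measure (ℝ × ℝ × ℝ)} (hπ : IsLiftedShadowCoupling μhat ν πhat) {u : ℝ}
    (hu : u ∈ Icc (0 : ℝ) 1) : (primitive πhat u).snd = N u :=
  (hπ.2 u hu).2.unique (hc.split u).isShadow

theorem integral_planOf_snd {κ : Kernel (ℝ × ℝ) ℝ} [IsProbabilityMeasure μhat] [IsMarkovKernel κ]
    {f : ℝ → ℝ} (hf : Integrable f (projY (planOf μhat κ))) :
    (∀ᵐ p ∂μhat, Integrable f (κ p)) ∧ Integrable (fun p => ∫ y, f y ∂κ p) μhat ∧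
      ∫ p, ∫ y, f y ∂κ p ∂μhat = ∫ y, f y ∂projY (planOf μhat κ) := by
  have h1 : projY (planOf μhat κ) = (μhat ⊗ₘ κ).map Prod.snd := by
    rw [projY, planOf, Measure.map_map (by fun_prop) MeasurableEquiv.prodAssoc.measurable]
    rfl
  rw [h1] at hf ⊢
  have h2 : Integrable (fun p : (ℝ × ℝ) × ℝ => f p.2) (μhat ⊗ₘ κ) :=
    hf.comp_measurable measurable_snd
  refine ⟨((Measure.integrable_compProd_iff h2.1).1 h2).1, h2.integral_compProd, ?_⟩
  rw [integral_map measurable_snd.aemeasurable hf.1, Measure.integral_compProd h2]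

/-- The laws of `(u, y)` agree, so almost every `κ' p` is carried by the support of `σ p.1`. Both
kernels integrate `√(1 + y²)` to the same total, its `ν`-integral, so the inequality of
`dilation_minimal` is an equality almost everywhere. -/
theorem IsShadowCurve.eq_planOf [IsProbabilityMeasure ν]
    (hc : IsShadowCurve μhat ν N σ) (hμ : FiniteFirstMoment μ) (h : IsLift μhat μ)
    {πhat : Measure (ℝ × ℝ × ℝ)} (hπ : IsLiftedShadowCoupling μhat ν πhat) :
    πhat = planOf μhat (shadowKernel σ (hc.antitone hμ h)) := by
  have := h.isProbabilityMeasure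
  have hν : FiniteFirstMoment ν := (hc.split 0).finiteFirstMoment
  have hπ₀ := hc.isLiftedShadowCoupling hμ h
  have hb := hc.ae_between_lift hμ h
  set κ := shadowKernel σ (hc.antitone hμ h) with hκ
  obtain ⟨κ', hκ', rfl, hbar⟩ := hπ.1.2.2
  change IsLiftedShadowCoupling μhat ν (planOf μhat κ') at hπ
  change planOf μhat κ' = _
  have hfst : ∀ {ξ : Kernel (ℝ × ℝ) ℝ} [IsMarkovKernel ξ],
      (projUY (planOf μhat ξ)).fst = unitLebesgue := fun {ξ} _ => by
    rw [fst_projUY, ← fst_projUX, projUX_planOf, h.1]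
  have hUY : projUY (planOf μhat κ') = projUY (planOf μhat κ) :=
    projUY_eq_of_primitive hfst hfst fun u hu => by
      rw [← primitive_projUY, ← primitive_projUY, hc.primitive_snd_eq hπ hu,
        hc.primitive_snd_eq hπ₀ hu]
  have hS := (measurableSet_mem_support (hc.antitone hμ h)).compl
  have h1 : projUY (planOf μhat κ) {p : ℝ × ℝ | p.2 ∈ (σ p.1).support}ᶜ = 0 := by
    rw [projUY_planOf_apply hS, lintegral_congr_ae (g := fun _ => 0), lintegral_zero]
    filter_upwards [hb] with p hp
    rw [hκ, shadowKernel_of_between hp]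
    exact dilation_compl Measure.isClosed_support hp
  have h2 : ∀ᵐ p ∂μhat, κ' p (σ p.1).supportᶜ = 0 := by
    rw [← hUY, projUY_planOf_apply hS, lintegral_eq_zero_iff] at h1
    · exact h1
    · exact Kernel.measurable_kernel_prodMk_left (κ := κ')
        (t := {q : (ℝ × ℝ) × ℝ | (q.1.1, q.2) ∈ {p : ℝ × ℝ | p.2 ∈ (σ p.1).support}ᶜ})
        ((by fun_prop : Measurable fun q : (ℝ × ℝ) × ℝ => (q.1.1, q.2)) hS)
  have hφ : Integrable (fun y => √(1 + y ^ 2)) ν := hν.integrable_of_le (by fun_prop) abs_sqrt_le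
  have hY : projY (planOf μhat κ) = ν := hπ₀.1.2.1
  have hY' : projY (planOf μhat κ') = ν := hπ.1.2.1
  obtain ⟨-, i2, i3⟩ := integral_planOf_snd (κ := κ) (hY.symm ▸ hφ)
  obtain ⟨-, j2, j3⟩ := integral_planOf_snd (κ := κ') (hY'.symm ▸ hφ)
  obtain ⟨j4, -⟩ := integral_planOf_snd (κ := κ') (hY'.symm ▸ hν.2)
  have hmin : ∀ᵐ p ∂μhat, ∫ y, √(1 + y ^ 2) ∂κ p ≤ ∫ y, √(1 + y ^ 2) ∂κ' p ∧
      (∫ y, √(1 + y ^ 2) ∂κ p = ∫ y, √(1 + y ^ 2) ∂κ' p → κ' p = κ p) := by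
    filter_upwards [hb, h2, j4, hbar] with p p1 p2 p3 p4
    rw [hκ, shadowKernel_of_between p1]
    exact dilation_minimal Measure.isClosed_support p1 p2 ⟨inferInstance, p3⟩ p4
  have hzero : ∫ p, (∫ y, √(1 + y ^ 2) ∂κ' p - ∫ y, √(1 + y ^ 2) ∂κ p) ∂μhat = 0 := by
    rw [integral_sub j2 i2, i3, j3, hY, hY', sub_self]
  have hae := (integral_eq_zero_iff_of_nonneg_ae (hmin.mono fun p hp => sub_nonneg.2 hp.1)
    (j2.sub i2)).1 hzero
  have heq : κ' =ᵐ[μhat] κ := by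
    filter_upwards [hmin, hae] with p p1 p2
    exact p1.2 (sub_eq_zero.1 p2).symm
  rw [planOf, planOf, Measure.compProd_congr heq]

end Uniqueness

end ShadowCoupling

/-! ### The main theorem -/

theorem mainTheorem3 (μ ν : MeasureTheory.Measure ℝ)
    [MeasureTheory.IsProbabilityMeasure μ] [MeasureTheory.IsProbabilityMeasure ν]
    (hμν : ShadowCoupling.ConvexOrder μ ν)
    (μhat : MeasureTheory.Measure (ℝ × ℝ)) (hμhat : ShadowCoupling.IsLift μhat μ) :
    ∃ πhat : MeasureTheory.Measure (ℝ × ℝ × ℝ),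
      -- existence
      ShadowCoupling.IsLiftedShadowCoupling μhat ν πhat ∧
      -- uniqueness
      (∀ πhat' : MeasureTheory.Measure (ℝ × ℝ × ℝ),
        ShadowCoupling.IsLiftedShadowCoupling μhat ν πhat' → πhat' = πhat) ∧
      -- wherever the derivatives exist, `ν_u = μ_u P_{T(u)}`
      (∀ u ∈ Set.Ico (0 : ℝ) 1, ∀ m n : MeasureTheory.Measure ℝ,
        ShadowCoupling.HasMeasureDerivAt (ShadowCoupling.primitive μhat) m u →
        ShadowCoupling.HasMeasureDerivAt (fun t => (ShadowCoupling.primitive πhat t).snd) n u →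
          ShadowCoupling.SupportWithin m (ShadowCoupling.remainingSupport ν πhat u) ∧
          n = ShadowCoupling.hittingProjection m (ShadowCoupling.remainingSupport ν πhat u)) ∧
      -- the derivatives exist almost everywhere and are given by the disintegrations
      (∀ κμ κν : ProbabilityTheory.Kernel ℝ ℝ,
        ShadowCoupling.IsDisintegration μhat κμ →
        ShadowCoupling.IsDisintegration (ShadowCoupling.projUY πhat) κν →
          ∀ᵐ u ∂ShadowCoupling.unitLebesgue,
            ShadowCoupling.HasMeasureDerivAt (ShadowCoupling.primitive μhat) (κμ u) u ∧
            ShadowCoupling.HasMeasureDerivAt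
              (fun t => (ShadowCoupling.primitive πhat t).snd) (κν u) u ∧
            ShadowCoupling.SupportWithin (κμ u) (ShadowCoupling.remainingSupport ν πhat u) ∧
            κν u = ShadowCoupling.hittingProjection (κμ u)
              (ShadowCoupling.remainingSupport ν πhat u)) := by
  open ShadowCoupling in
  obtain ⟨N, σ, hc⟩ := exists_isShadowCurve hμν hμhat
  have hμ := hμν.1
  have hν := hμν.2.1
  have hπ := hc.isLiftedShadowCoupling hμ hμhat
  set πhat := planOf μhat (shadowKernel σ (hc.antitone hμ hμhat))
  have hN : ∀ t ∈ Set.Icc (0 : ℝ) 1, (primitive πhat t).snd = N t :=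
    fun t ht => hc.primitive_snd_eq hπ ht
  have hder : ∀ u ∈ Set.Ico (0 : ℝ) 1, ∀ m n : MeasureTheory.Measure ℝ,
      HasMeasureDerivAt (primitive μhat) m u →
      HasMeasureDerivAt (fun t => (primitive πhat t).snd) n u →
      SupportWithin m (remainingSupport ν πhat u) ∧
        n = hittingProjection m (remainingSupport ν πhat u) := by
    intro u hu m n hm hn
    have hrem : remainingSupport ν πhat u = (σ u).support := by
      rw [remainingSupport, hN u ⟨hu.1, hu.2.le⟩, hc.sub_eq]
    rw [hrem]
    exact hc.eq_hittingProjection hμ hμhat hu hm hN hn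
  refine ⟨πhat, hπ, fun π' hπ' => hc.eq_planOf hμ hμhat hπ', hder, fun κμ κν hκμ hκν => ?_⟩
  have h2 := ae_hasMeasureDerivAt hκν (by rw [snd_projUY, hπ.1.2.1]; exact hν)
  filter_upwards [ae_hasMeasureDerivAt hκμ (by rw [hμhat.2]; exact hμ), h2, ae_mem_Ico]
    with u u1 u2 u3
  have u2' : HasMeasureDerivAt (fun t => (primitive πhat t).snd) (κν u) u := by
    simp_rw [primitive_projUY]
    exact u2
  exact ⟨u1, u2', hder u u3 _ _ u1 u2'⟩
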